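/- Let $\lambda=(\lambda_1,\dots,\lambda_n)\in\mathbb R^n$ with $0<\lambda_1\le\cdots\le\lambda_n$. Let $G_\lambda$ be the oscillator group, that is, the Lie group with underlying manifold $\mathbb R\times\mathbb R\times\mathbb C^n$ and product $$(t,s,z)\cdot(t',s',z')=\Big(t+t',\ s+s'+\tfrac12\sum_{j=1}^n\operatorname{Im}\big(\bar z_j e^{it\lambda_j}z'_j\big),\ \big(z_j+e^{it\lambda_j}z'_j\big)_{1\le j\le n}\Big).$$ Its Lie algebra $\mathcal G_\lambda$ (the oscillator algebra) has the basis $e_{-1}=\partial_t$, $e_0=\partial_s$, $e_j=\partial_{\operatorname{Re}z_j}$, $\check e_j=\partial_{\operatorname{Im}z_j}$ ($1\le j\le n$) at the identity, with $$[e_{-1},e_j]=\lambda_j\check e_j,\qquad [e_j,\check e_j]=e_0,\qquad [e_{-1},\check e_j]=-\lambda_j e_j,$$ the other brackets being zero or deduced by antisymmetry. Let $\mathbf k_\lambda$ be the nondegenerate symmetric bilinear form on $\mathcal G_\lambda$ with $$\mathbf k_\lambda(x,x)=2x_{-1}x_0+\sum_{j=1}^n\frac1{\lambda_j}\big(x_j^2+\check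 x_j^2\big),\qquad x=\sum_{j=-1}^n x_je_j+\sum_{j=1}^n\check x_j\check e_j.$$ Let $u:\mathcal G_\lambda\to\mathcal G_\lambda$ be an isomorphism of vector spaces which is $\mathbf k_\lambda$-symmetric, i.e. $\mathbf k_\lambda(u(x),y)=\mathbf k_\lambda(x,u(y))$ for all $x,y$, and let $\mathbf k_u$ be the left-invariant pseudo-Riemannian metric on $G_\lambda$ given at the identity by $\mathbf k_u(x,y)=\mathbf k_\lambda(u(x),y)$. 1. If $u$ leaves the center of $\mathcal G_\lambda$ stable, then $u$ also leaves the derived ideal $[\mathcal G_\lambda,\mathcal G_\lambda]$ stable. 2. If $u$ leaves stable either the center of $\mathcal G_\lambda$ or some Cartan subalgebra of $\mathcal G_\lambda$, then the metric $\mathbf k_u$ on $G_\lambda$ is geodesically complete: for every $p\in G_\lambda$ and every $v\in T_pG_\lambda$ there is a geodesic $\gamma:\mathbb R\to G_\lambda$ of $\mathbf k_u$ with $\gamma(0)=p$ and $\gamma'(0)=v$. -/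

import Mathlib

open scoped Manifold ContDiff

noncomputable section

/-- The oscillator algebra `𝒢_lam`. An element `(a, b, z)` stands for
`a e₋₁ + b e₀ + ∑ j, ((z j).re e_j + (z j).im ě_j)`. -/
def OscAlgebra {n : ℕ} (_lam : Fin n → ℝ) : Type := ℝ × ℝ × (Fin n → ℂ)

/-- The underlying manifold `ℝ × ℝ × ℂⁿ` of the oscillator group `G_lam`; an element is
`(t, s, z)`. -/
def OscGroup {n : ℕ} (_lam : Fin n → ℝ) : Type := ℝ × ℝ × (Fin n → ℂ)

namespace OscAlgebra

variable {n : ℕ} {lam : Fin n → ℝ}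

instance : AddCommGroup (OscAlgebra lam) := inferInstanceAs (AddCommGroup (ℝ × ℝ × (Fin n → ℂ)))
instance : Module ℝ (OscAlgebra lam) := inferInstanceAs (Module ℝ (ℝ × ℝ × (Fin n → ℂ)))
instance : FiniteDimensional ℝ (OscAlgebra lam) :=
  inferInstanceAs (FiniteDimensional ℝ (ℝ × ℝ × (Fin n → ℂ)))

/-- The coordinate along `e₋₁`. -/
def xm (x : OscAlgebra lam) : ℝ := x.1
/-- The coordinate along `e₀`. -/
def x0 (x : OscAlgebra lam) : ℝ := x.2.1
/-- The coordinates along `e_j` (real part) and `ě_j` (imaginary part). -/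
def zc (x : OscAlgebra lam) : Fin n → ℂ := x.2.2

/-- The element with the given coordinates. -/
def mk (a b : ℝ) (z : Fin n → ℂ) : OscAlgebra lam := (a, b, z)

@[ext] theorem ext' {x y : OscAlgebra lam} (h1 : xm x = xm y) (h2 : x0 x = x0 y)
    (h3 : ∀ j, zc x j = zc y j) : x = y :=
  Prod.ext h1 (Prod.ext h2 (funext h3))

@[simp] theorem xm_mk (a b : ℝ) (z : Fin n → ℂ) : xm (mk (lam := lam) a b z) = a := rfl
@[simp] theorem x0_mk (a b : ℝ) (z : Fin n → ℂ) : x0 (mk (lam := lam) a b z) = b := rfl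
@[simp] theorem zc_mk (a b : ℝ) (z : Fin n → ℂ) : zc (mk (lam := lam) a b z) = z := rfl
@[simp] theorem xm_add (x y : OscAlgebra lam) : xm (x + y) = xm x + xm y := rfl
@[simp] theorem x0_add (x y : OscAlgebra lam) : x0 (x + y) = x0 x + x0 y := rfl
@[simp] theorem zc_add (x y : OscAlgebra lam) (j : Fin n) : zc (x + y) j = zc x j + zc y j := rfl
@[simp] theorem xm_zero : xm (0 : OscAlgebra lam) = 0 := rfl
@[simp] theorem x0_zero : x0 (0 : OscAlgebra lam) = 0 := rfl
@[simp] theorem zc_zero (j : Fin n) : zc (0 : OscAlgebra lam) j = 0 := rfl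
@[simp] theorem xm_smul (c : ℝ) (x : OscAlgebra lam) : xm (c • x) = c * xm x := rfl
@[simp] theorem x0_smul (c : ℝ) (x : OscAlgebra lam) : x0 (c • x) = c * x0 x := rfl
@[simp] theorem zc_smul (c : ℝ) (x : OscAlgebra lam) (j : Fin n) :
    zc (c • x) j = c * zc x j := by
  change c • (x.2.2 j) = _
  exact Complex.real_smul

/-- `[e₋₁, e_j] = lam_j ě_j`, `[e_j, ě_j] = e₀`, `[e₋₁, ě_j] = -lam_j e_j`, the other brackets of
basis vectors being zero or deduced by antisymmetry. -/
instance : Bracket (OscAlgebra lam) (OscAlgebra lam) where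
  bracket x y := mk 0 (∑ j, ((zc x j).re * (zc y j).im - (zc x j).im * (zc y j).re))
    (fun j => Complex.I * (lam j : ℂ) * (xm x * zc y j - xm y * zc x j))

theorem bracket_def (x y : OscAlgebra lam) :
    ⁅x, y⁆ = mk 0 (∑ j, ((zc x j).re * (zc y j).im - (zc x j).im * (zc y j).re))
      (fun j => Complex.I * (lam j : ℂ) * (xm x * zc y j - xm y * zc x j)) := rfl

instance : LieRing (OscAlgebra lam) where
  add_lie x y z := by
    ext j
    · simp [bracket_def]
    · simp only [bracket_def, x0_mk, x0_add, ← Finset.sum_add_distrib]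
      refine Finset.sum_congr rfl fun j _ => ?_
      simp; ring
    · simp [bracket_def]; ring
  lie_add x y z := by
    ext j
    · simp [bracket_def]
    · simp only [bracket_def, x0_mk, x0_add, ← Finset.sum_add_distrib]
      refine Finset.sum_congr rfl fun j _ => ?_
      simp; ring
    · simp [bracket_def]; ring
  lie_self x := by
    ext j
    · simp [bracket_def]
    · simp only [bracket_def, x0_mk, x0_zero]
      refine Finset.sum_eq_zero fun j _ => by ring
    · simp [bracket_def]
  leibniz_lie x y z := by
    ext j
    · simp [bracket_def]
    · simp only [bracket_def, x0_mk, x0_add, zc_mk, xm_mk, ← Finset.sum_add_distrib]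
      refine Finset.sum_congr rfl fun j _ => ?_
      simp; ring
    · simp [bracket_def]; ring

instance : LieAlgebra ℝ (OscAlgebra lam) where
  lie_smul c x y := by
    ext j
    · simp [bracket_def]
    · simp only [bracket_def, x0_mk, x0_smul, Finset.mul_sum]
      refine Finset.sum_congr rfl fun j _ => ?_
      simp; ring
    · simp [bracket_def]; ring

/-- The symmetric form `k_lam` whose quadratic form is
`2 x₋₁ x₀ + ∑ j, (1 / lam_j) (x_j ^ 2 + x̌_j ^ 2)`. -/
def kForm (lam : Fin n → ℝ) : LinearMap.BilinForm ℝ (OscAlgebra lam) :=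
  LinearMap.mk₂ ℝ
    (fun x y => xm x * x0 y + x0 x * xm y +
      ∑ j, (1 / lam j) * ((zc x j).re * (zc y j).re + (zc x j).im * (zc y j).im))
    (by
      intro x y z
      have : ∀ j, (1 / lam j) * ((zc (x + y) j).re * (zc z j).re + (zc (x + y) j).im * (zc z j).im)
          = (1 / lam j) * ((zc x j).re * (zc z j).re + (zc x j).im * (zc z j).im)
          + (1 / lam j) * ((zc y j).re * (zc z j).re + (zc y j).im * (zc z j).im) := by
        intro j; simp only [zc_add, Complex.add_re, Complex.add_im]; ring
      simp only [this, Finset.sum_add_distrib, xm_add, x0_add]; ring)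
    (by
      intro c x z
      have : ∀ j, (1 / lam j) * ((zc (c • x) j).re * (zc z j).re + (zc (c • x) j).im * (zc z j).im)
          = c * ((1 / lam j) * ((zc x j).re * (zc z j).re + (zc x j).im * (zc z j).im)) := by
        intro j; simp; ring
      simp only [this, ← Finset.mul_sum, xm_smul, x0_smul, smul_eq_mul]; ring)
    (by
      intro z x y
      have : ∀ j, (1 / lam j) * ((zc z j).re * (zc (x + y) j).re + (zc z j).im * (zc (x + y) j).im)
          = (1 / lam j) * ((zc z j).re * (zc x j).re + (zc z j).im * (zc x j).im)
          + (1 / lam j) * ((zc z j).re * (zc y j).re + (zc z j).im * (zc y j).im) := by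
        intro j; simp only [zc_add, Complex.add_re, Complex.add_im]; ring
      simp only [this, Finset.sum_add_distrib, xm_add, x0_add]; ring)
    (by
      intro c z x
      have : ∀ j, (1 / lam j) * ((zc z j).re * (zc (c • x) j).re + (zc z j).im * (zc (c • x) j).im)
          = c * ((1 / lam j) * ((zc z j).re * (zc x j).re + (zc z j).im * (zc x j).im)) := by
        intro j; simp; ring
      simp only [this, ← Finset.mul_sum, xm_smul, x0_smul, smul_eq_mul]; ring)

theorem kForm_apply (x y : OscAlgebra lam) :
    kForm lam x y = xm x * x0 y + x0 x * xm y +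
      ∑ j, (1 / lam j) * ((zc x j).re * (zc y j).re + (zc x j).im * (zc y j).im) := rfl

theorem kForm_comm (x y : OscAlgebra lam) : kForm lam x y = kForm lam y x := by
  simp only [kForm_apply]
  congr 1
  · ring
  · exact Finset.sum_congr rfl fun j _ => by ring

theorem kForm_nondeg (hlam : ∀ j, 0 < lam j) (x : OscAlgebra lam)
    (hx : ∀ y, kForm lam x y = 0) : x = 0 := by
  have h1 := hx (mk 0 1 0)
  have h2 := hx (mk 1 0 0)
  have h3 : xm x = 0 := by simpa [kForm_apply] using h1
  have h4 : x0 x = 0 := by simpa [kForm_apply] using h2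
  have h5 := hx x
  rw [kForm_apply, h3, h4] at h5
  have h6 : ∑ j, (1 / lam j) * ((zc x j).re * (zc x j).re + (zc x j).im * (zc x j).im) = 0 := by
    simpa using h5
  rw [Finset.sum_eq_zero_iff_of_nonneg (fun j _ => by
    have := hlam j
    have := mul_self_nonneg (zc x j).re
    have := mul_self_nonneg (zc x j).im
    positivity)] at h6
  ext j
  · exact h3
  · exact h4
  · have h7 := h6 j (Finset.mem_univ j)
    have h8 : (1 / lam j) ≠ 0 := by have := hlam j; positivity
    have h9 := (mul_eq_zero.mp h7).resolve_left h8
    have h10 : Complex.normSq (zc x j) = 0 := by rw [Complex.normSq_apply]; exact h9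
    simpa using h10

end OscAlgebra

namespace OscGroup

variable {n : ℕ} {lam : Fin n → ℝ}

instance : NormedAddCommGroup (OscGroup lam) :=
  inferInstanceAs (NormedAddCommGroup (ℝ × ℝ × (Fin n → ℂ)))
instance : NormedSpace ℝ (OscGroup lam) :=
  inferInstanceAs (NormedSpace ℝ (ℝ × ℝ × (Fin n → ℂ)))
instance : FiniteDimensional ℝ (OscGroup lam) :=
  inferInstanceAs (FiniteDimensional ℝ (ℝ × ℝ × (Fin n → ℂ)))

/-- The coordinate `t`. -/
def t (g : OscGroup lam) : ℝ := g.1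
/-- The coordinate `s`. -/
def s (g : OscGroup lam) : ℝ := g.2.1
/-- The coordinates `z_1, …, z_n`. -/
def z (g : OscGroup lam) : Fin n → ℂ := g.2.2

/-- The point with the given coordinates. -/
def mk (a b : ℝ) (c : Fin n → ℂ) : OscGroup lam := (a, b, c)

@[ext] theorem ext' {x y : OscGroup lam} (h1 : t x = t y) (h2 : s x = s y)
    (h3 : ∀ j, z x j = z y j) : x = y :=
  Prod.ext h1 (Prod.ext h2 (funext h3))

@[simp] theorem t_mk (a b : ℝ) (c : Fin n → ℂ) : t (mk (lam := lam) a b c) = a := rfl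
@[simp] theorem s_mk (a b : ℝ) (c : Fin n → ℂ) : s (mk (lam := lam) a b c) = b := rfl
@[simp] theorem z_mk (a b : ℝ) (c : Fin n → ℂ) : z (mk (lam := lam) a b c) = c := rfl

/-- The rotation factor `exp (i t lam_j)`. -/
def rot (lam : Fin n → ℝ) (a : ℝ) (j : Fin n) : ℂ := Complex.exp (Complex.I * (a * lam j))

theorem rot_add (a b : ℝ) (j : Fin n) : rot lam (a + b) j = rot lam a j * rot lam b j := by
  simp only [rot, ← Complex.exp_add]; congr 1; push_cast; ring

@[simp] theorem rot_zero (j : Fin n) : rot lam 0 j = 1 := by simp [rot]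

theorem conj_rot (a : ℝ) (j : Fin n) : (starRingEnd ℂ) (rot lam a j) = rot lam (-a) j := by
  simp [rot, ← Complex.exp_conj]

theorem rot_neg_mul (a : ℝ) (j : Fin n) : rot lam (-a) j * rot lam a j = 1 := by
  rw [← rot_add]; simp

instance : Mul (OscGroup lam) where
  mul g h := mk (t g + t h)
    (s g + s h + (1 / 2) * ∑ j, ((starRingEnd ℂ) (z g j) * rot lam (t g) j * z h j).im)
    (fun j => z g j + rot lam (t g) j * z h j)

instance : One (OscGroup lam) where
  one := mk 0 0 0

instance : Inv (OscGroup lam) where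
  inv g := mk (-t g) (-s g) (fun j => -(rot lam (-t g) j * z g j))

theorem mul_def (g h : OscGroup lam) : g * h = mk (t g + t h)
    (s g + s h + (1 / 2) * ∑ j, ((starRingEnd ℂ) (z g j) * rot lam (t g) j * z h j).im)
    (fun j => z g j + rot lam (t g) j * z h j) := rfl

theorem one_def : (1 : OscGroup lam) = mk 0 0 0 := rfl

theorem inv_def (g : OscGroup lam) :
    g⁻¹ = mk (-t g) (-s g) (fun j => -(rot lam (-t g) j * z g j)) := rfl

instance : Group (OscGroup lam) :=
  Group.ofLeftAxioms
    (by
      intro a b c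
      ext j
      · simp [mul_def]; ring
      · simp only [mul_def, s_mk, t_mk, z_mk]
        have key : ∀ j, ((starRingEnd ℂ) (z a j) * rot lam (t a) j * z b j).im +
            ((starRingEnd ℂ) (z a j + rot lam (t a) j * z b j) * rot lam (t a + t b) j * z c j).im
            = ((starRingEnd ℂ) (z b j) * rot lam (t b) j * z c j).im +
            ((starRingEnd ℂ) (z a j) * rot lam (t a) j * (z b j + rot lam (t b) j * z c j)).im := by
          intro j
          rw [← Complex.add_im, ← Complex.add_im]
          congr 1
          rw [map_add, map_mul, conj_rot, rot_add]
          linear_combination ((starRingEnd ℂ) (z b j) * rot lam (t b) j * z c j) *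
            rot_neg_mul (lam := lam) (t a) j
        have := Finset.sum_congr rfl (fun j (_ : j ∈ Finset.univ) => key j)
        rw [Finset.sum_add_distrib, Finset.sum_add_distrib] at this
        linarith
      · simp [mul_def, rot_add]; ring)
    (by
      intro a
      ext j
      · simp [mul_def, one_def]
      · simp [mul_def, one_def]
      · simp [mul_def, one_def])
    (by
      intro a
      ext j
      · simp [mul_def, one_def, inv_def]
      · simp only [mul_def, one_def, inv_def, s_mk, t_mk, z_mk]
        have key : ∀ j, ((starRingEnd ℂ) (-(rot lam (-t a) j * z a j)) * rot lam (-t a) j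
            * z a j).im = 0 := by
          intro j
          have h : (starRingEnd ℂ) (-(rot lam (-t a) j * z a j)) * rot lam (-t a) j * z a j
              = ((-Complex.normSq (z a j) : ℝ) : ℂ) := by
            rw [map_neg, map_mul, conj_rot, neg_neg]
            push_cast
            rw [Complex.normSq_eq_conj_mul_self]
            linear_combination -((starRingEnd ℂ) (z a j) * z a j) *
              rot_neg_mul (lam := lam) (t a) j
          rw [h, Complex.ofReal_im]
        rw [Finset.sum_eq_zero fun j _ => key j]
        simp
      · simp [mul_def, one_def, inv_def])

theorem contDiff_t {k : WithTop ℕ∞} : ContDiff ℝ k (t : OscGroup lam → ℝ) :=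
  contDiff_fst (E := ℝ) (F := ℝ × (Fin n → ℂ))

theorem contDiff_s {k : WithTop ℕ∞} : ContDiff ℝ k (s : OscGroup lam → ℝ) :=
  (contDiff_fst (E := ℝ) (F := Fin n → ℂ)).comp (contDiff_snd (E := ℝ) (F := ℝ × (Fin n → ℂ)))

theorem contDiff_z {k : WithTop ℕ∞} (j : Fin n) :
    ContDiff ℝ k (fun g : OscGroup lam => z g j) :=
  (contDiff_apply ℝ ℂ j).comp
    ((contDiff_snd (E := ℝ) (F := Fin n → ℂ)).comp (contDiff_snd (E := ℝ) (F := ℝ × (Fin n → ℂ))))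

theorem contDiff_mk {F : Type*} [NormedAddCommGroup F] [NormedSpace ℝ F] {k : WithTop ℕ∞}
    {a b : F → ℝ} {c : F → Fin n → ℂ} (ha : ContDiff ℝ k a) (hb : ContDiff ℝ k b)
    (hc : ∀ j, ContDiff ℝ k (fun p => c p j)) :
    ContDiff ℝ k (fun p => mk (lam := lam) (a p) (b p) (c p)) :=
  ha.prodMk (hb.prodMk (contDiff_pi.2 hc))

theorem contDiff_rot {F : Type*} [NormedAddCommGroup F] [NormedSpace ℝ F] {k : WithTop ℕ∞}
    {a : F → ℝ} (ha : ContDiff ℝ k a) (j : Fin n) : ContDiff ℝ k (fun p => rot lam (a p) j) := by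
  have h : ContDiff ℝ k (fun p => ((a p : ℝ) : ℂ)) := Complex.ofRealCLM.contDiff.comp ha
  exact (contDiff_const.mul (h.mul contDiff_const)).cexp

theorem contDiff_mul' {k : WithTop ℕ∞} :
    ContDiff ℝ k (fun p : OscGroup lam × OscGroup lam => p.1 * p.2) := by
  have h1 : ContDiff ℝ k (Prod.fst : OscGroup lam × OscGroup lam → OscGroup lam) := contDiff_fst
  have h2 : ContDiff ℝ k (Prod.snd : OscGroup lam × OscGroup lam → OscGroup lam) := contDiff_snd
  refine contDiff_mk ((contDiff_t.comp h1).add (contDiff_t.comp h2)) ?_ fun j => ?_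
  · refine ((contDiff_s.comp h1).add (contDiff_s.comp h2)).add (contDiff_const.mul ?_)
    refine ContDiff.sum fun j _ => ?_
    exact Complex.imCLM.contDiff.comp
      (((Complex.conjCLE.toContinuousLinearMap.contDiff.comp ((contDiff_z j).comp h1)).mul
        (contDiff_rot (contDiff_t.comp h1) j)).mul ((contDiff_z j).comp h2))
  · exact ((contDiff_z j).comp h1).add
      ((contDiff_rot (contDiff_t.comp h1) j).mul ((contDiff_z j).comp h2))

theorem contDiff_inv' {k : WithTop ℕ∞} : ContDiff ℝ k (fun p : OscGroup lam => p⁻¹) := by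
  refine contDiff_mk contDiff_t.neg contDiff_s.neg fun j => ?_
  exact ((contDiff_rot contDiff_t.neg j).mul (contDiff_z j)).neg

/-- `G_lam` is a Lie group. -/
instance {k : WithTop ℕ∞} : LieGroup 𝓘(ℝ, OscGroup lam) k (OscGroup lam) where
  contMDiff_mul := by
    have h := (contDiff_mul' (lam := lam) (k := k)).contMDiff
    rwa [modelWithCornersSelf_prod, ← chartedSpaceSelf_prod] at h
  contMDiff_inv := contDiff_inv'.contMDiff

@[simp] theorem t_add (x y : OscGroup lam) : t (x + y) = t x + t y := rfl
@[simp] theorem s_add (x y : OscGroup lam) : s (x + y) = s x + s y := rfl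
@[simp] theorem z_add (x y : OscGroup lam) (j : Fin n) : z (x + y) j = z x j + z y j := rfl
@[simp] theorem t_sub (x y : OscGroup lam) : t (x - y) = t x - t y := rfl
@[simp] theorem s_sub (x y : OscGroup lam) : s (x - y) = s x - s y := rfl
@[simp] theorem z_sub (x y : OscGroup lam) (j : Fin n) : z (x - y) j = z x j - z y j := rfl
@[simp] theorem t_smul (c : ℝ) (x : OscGroup lam) : t (c • x) = c * t x := rfl
@[simp] theorem s_smul (c : ℝ) (x : OscGroup lam) : s (c • x) = c * s x := rfl
@[simp] theorem z_smul (c : ℝ) (x : OscGroup lam) (j : Fin n) :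
    z (c • x) j = c * z x j := by
  change c • (x.2.2 j) = _
  exact Complex.real_smul

/-- The differential of the left translation by `p`, in coordinates (it is the same at all
points). -/
def dL (p w : OscGroup lam) : OscGroup lam :=
  mk (t w) (s w + (1 / 2) * ∑ j, ((starRingEnd ℂ) (z p j) * rot lam (t p) j * z w j).im)
    (fun j => rot lam (t p) j * z w j)

theorem mul_add_smul (p q w : OscGroup lam) (c : ℝ) : p * (q + c • w) = p * q + c • dL p w := by
  ext j
  · simp [mul_def, dL]; ring
  · simp only [mul_def, dL, s_mk, s_add, s_smul]
    have key : ∀ j, ((starRingEnd ℂ) (z p j) * rot lam (t p) j * z (q + c • w) j).im =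
        ((starRingEnd ℂ) (z p j) * rot lam (t p) j * z q j).im +
        c * ((starRingEnd ℂ) (z p j) * rot lam (t p) j * z w j).im := by
      intro j
      rw [← Complex.im_ofReal_mul, ← Complex.add_im, z_add, z_smul]
      congr 1
      ring
    simp only [key, Finset.sum_add_distrib, ← Finset.mul_sum]
    ring
  · simp [mul_def, dL]; ring

theorem dL_dL (p q w : OscGroup lam) : dL p (dL q w) = dL (p * q) w := by
  have h := mul_assoc p q (1 + (1 : ℝ) • w)
  rw [mul_add_smul, mul_add_smul, mul_add_smul] at h
  simpa using h.symm

theorem dL_one (w : OscGroup lam) : dL 1 w = w := by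
  ext j <;> simp [dL, one_def]

theorem contDiff_mul_left' {k : WithTop ℕ∞} (p : OscGroup lam) :
    ContDiff ℝ k (fun h : OscGroup lam => p * h) :=
  contDiff_mul'.comp (contDiff_const.prodMk contDiff_id)

theorem fderiv_mul_left (p q w : OscGroup lam) :
    fderiv ℝ (fun h : OscGroup lam => p * h) q w = dL p w := by
  have hd : DifferentiableAt ℝ (fun h : OscGroup lam => p * h) q :=
    (contDiff_mul_left' (k := 1) p).differentiable (by norm_num) q
  have h1 : HasDerivAt (fun c : ℝ => p * (q + c • w))
      (fderiv ℝ (fun h : OscGroup lam => p * h) q w) 0 := hd.hasFDerivAt.hasLineDerivAt w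
  have h2 : HasDerivAt (fun c : ℝ => p * (q + c • w)) (dL p w) 0 := by
    simp only [mul_add_smul]
    simpa using ((hasDerivAt_id (0 : ℝ)).smul_const (dL p w)).const_add (p * q)
  exact h1.unique h2

theorem contDiff_dL {k : WithTop ℕ∞} (w : OscGroup lam) :
    ContDiff ℝ k (fun p : OscGroup lam => dL p w) := by
  refine contDiff_mk contDiff_const (contDiff_const.add (contDiff_const.mul ?_)) fun j => ?_
  · refine ContDiff.sum fun j _ => ?_
    exact Complex.imCLM.contDiff.comp
      (((Complex.conjCLE.toContinuousLinearMap.contDiff.comp (contDiff_z j)).mul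
        (contDiff_rot contDiff_t j)).mul contDiff_const)
  · exact (contDiff_rot contDiff_t j).mul contDiff_const

theorem mulInvariantVectorField_eq (w : GroupLieAlgebra 𝓘(ℝ, OscGroup lam) (OscGroup lam)) :
    mulInvariantVectorField (I := 𝓘(ℝ, OscGroup lam)) (G := OscGroup lam) w =
      fun p => dL p w := by
  funext p
  rw [← fderiv_mul_left p 1 w, ← mfderiv_eq_fderiv]
  rfl

theorem hasDerivAt_mk {a b : ℝ → ℝ} {c : ℝ → Fin n → ℂ} {a' b' x : ℝ} {c' : Fin n → ℂ}
    (ha : HasDerivAt a a' x) (hb : HasDerivAt b b' x)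
    (hc : ∀ j, HasDerivAt (fun r => c r j) (c' j) x) :
    HasDerivAt (fun r => mk (lam := lam) (a r) (b r) (c r)) (mk a' b' c') x :=
  (HasDerivAt.prodMk ha (HasDerivAt.prodMk hb (hasDerivAt_pi.2 hc)) :
    HasDerivAt (fun r => ((a r, b r, c r) : ℝ × ℝ × (Fin n → ℂ))) (a', b', c') x)

theorem fderiv_dL_one (v w : OscGroup lam) :
    fderiv ℝ (fun p : OscGroup lam => dL p w) 1 v =
      mk 0 ((1 / 2) * ∑ j, ((starRingEnd ℂ) (z v j) * z w j).im)
        (fun j => Complex.I * (t v * lam j) * z w j) := by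
  have hd : DifferentiableAt ℝ (fun p : OscGroup lam => dL p w) 1 :=
    (contDiff_dL (k := 1) w).differentiable (by norm_num) 1
  have h1 : HasDerivAt (fun c : ℝ => dL ((1 : OscGroup lam) + c • v) w)
      (fderiv ℝ (fun p : OscGroup lam => dL p w) 1 v) 0 := hd.hasFDerivAt.hasLineDerivAt v
  have hrot : ∀ j, HasDerivAt (fun c : ℝ => rot lam (c * t v) j)
      (Complex.I * (t v * lam j)) 0 := by
    intro j
    have e : HasDerivAt (fun c : ℝ => Complex.I * (((c * t v : ℝ) : ℂ) * lam j))
        (Complex.I * (t v * lam j)) 0 := by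
      have e0 : HasDerivAt (fun c : ℝ => c * t v) (t v) 0 := by
        simpa using (hasDerivAt_id (0 : ℝ)).mul_const (t v)
      exact (e0.ofReal_comp.mul_const _).const_mul _
    simpa [rot] using e.cexp
  have h2 : HasDerivAt (fun c : ℝ => dL ((1 : OscGroup lam) + c • v) w)
      (mk 0 ((1 / 2) * ∑ j, ((starRingEnd ℂ) (z v j) * z w j).im)
        (fun j => Complex.I * (t v * lam j) * z w j)) 0 := by
    have ht : ∀ c : ℝ, t ((1 : OscGroup lam) + c • v) = c * t v := by
      intro c; simp [one_def]
    have hz : ∀ (c : ℝ) j, z ((1 : OscGroup lam) + c • v) j = c * z v j := by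
      intro c j; simp [one_def]
    simp only [dL, ht, hz]
    refine hasDerivAt_mk (hasDerivAt_const _ _) ?_ ?_
    · refine HasDerivAt.const_add _ (HasDerivAt.const_mul _ (HasDerivAt.fun_sum fun j _ => ?_))
      have e1 : HasDerivAt (fun c : ℝ => (starRingEnd ℂ) ((c : ℂ) * z v j))
          ((starRingEnd ℂ) (z v j)) 0 := by
        have := (hasDerivAt_id (0 : ℝ)).ofReal_comp.mul_const ((starRingEnd ℂ) (z v j))
        simpa using this
      have e2 := (e1.mul (hrot j)).mul_const (z w j)
      have e3 := Complex.imCLM.hasFDerivAt.comp_hasDerivAt (0 : ℝ) e2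
      refine e3.congr_deriv ?_
      simp
    · intro j
      exact (hrot j).mul_const (z w j)
  exact h1.unique h2

open VectorField in
theorem mlieBracket_eq (V W : (x : OscGroup lam) → TangentSpace 𝓘(ℝ, OscGroup lam) x)
    (x : OscGroup lam) :
    mlieBracket 𝓘(ℝ, OscGroup lam) V W x = lieBracket ℝ V W x := by
  rw [← mlieBracketWithin_univ, mlieBracketWithin_eq_lieBracketWithin]
  exact congrFun (lieBracketWithin_univ (𝕜 := ℝ) (V := V) (W := W)) x

open VectorField in
theorem lieBracket_dL (v w : OscGroup lam) :
    lieBracket ℝ (fun p => dL p v) (fun p => dL p w) (1 : OscGroup lam) =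
      mk 0 ((1 / 2) * ∑ j, ((starRingEnd ℂ) (z v j) * z w j).im)
        (fun j => Complex.I * (t v * lam j) * z w j) -
      mk 0 ((1 / 2) * ∑ j, ((starRingEnd ℂ) (z w j) * z v j).im)
        (fun j => Complex.I * (t w * lam j) * z v j) := by
  rw [lieBracket, dL_one, dL_one, fderiv_dL_one, fderiv_dL_one]

theorem groupLieAlgebra_bracket (v w : GroupLieAlgebra 𝓘(ℝ, OscGroup lam) (OscGroup lam)) :
    ⁅v, w⁆ = (mk 0 ((1 / 2) * ∑ j, ((starRingEnd ℂ) (z v j) * z w j).im)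
        (fun j => Complex.I * (t v * lam j) * z w j) : OscGroup lam) -
      (mk 0 ((1 / 2) * ∑ j, ((starRingEnd ℂ) (z w j) * z v j).im)
        (fun j => Complex.I * (t w * lam j) * z v j) : OscGroup lam) := by
  rw [GroupLieAlgebra.bracket_def, mulInvariantVectorField_eq, mulInvariantVectorField_eq]
  exact (mlieBracket_eq _ _ _).trans (lieBracket_dL v w)

end OscGroup

/-- The identification of `𝒢_lam` with the Lie algebra of `G_lam` (the tangent space at the
identity with the bracket of left-invariant vector fields): `e₋₁ = ∂/∂t`, `e₀ = ∂/∂s`, and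
`e_j`, `ě_j` are the partial derivatives along the real and imaginary parts of `z_j`. -/
def OscAlgebra.equivLie {n : ℕ} (lam : Fin n → ℝ) :
    OscAlgebra lam ≃ₗ⁅ℝ⁆ GroupLieAlgebra 𝓘(ℝ, OscGroup lam) (OscGroup lam) where
  toFun x := OscGroup.mk x.xm x.x0 x.zc
  invFun g := OscAlgebra.mk (OscGroup.t g) (OscGroup.s g) (OscGroup.z g)
  map_add' _ _ := rfl
  map_smul' _ _ := rfl
  left_inv _ := rfl
  right_inv _ := rfl
  map_lie' := by
    intro x y
    refine Eq.trans ?_ (OscGroup.groupLieAlgebra_bracket _ _).symm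
    refine OscGroup.ext' ?_ ?_ fun j => ?_
    · simp [OscAlgebra.bracket_def]
    · simp only [OscAlgebra.bracket_def, OscGroup.s_sub, OscGroup.s_mk, OscGroup.z_mk,
        OscAlgebra.x0_mk, ← mul_sub, ← Finset.sum_sub_distrib, Finset.mul_sum]
      refine Finset.sum_congr rfl fun j _ => ?_
      simp; ring
    · simp [OscAlgebra.bracket_def]; ring

/-- A (smooth) pseudo-Riemannian metric on the manifold `E`, a finite-dimensional real vector
space: `g p v w` is the product at the point `p` of the tangent vectors `v` and `w`. -/
structure PseudoRiemannianMetric (E : Type*) [NormedAddCommGroup E] [NormedSpace ℝ E]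
    [FiniteDimensional ℝ E] where
  g : E → LinearMap.BilinForm ℝ E
  symm : ∀ p v w, g p v w = g p w v
  nondegenerate : ∀ p v, (∀ w, g p v w = 0) → v = 0
  smooth : ∀ v w, ContDiff ℝ ∞ (fun p => g p v w)

namespace PseudoRiemannianMetric

variable {E : Type*} [NormedAddCommGroup E] [NormedSpace ℝ E] [FiniteDimensional ℝ E]

/-- The Christoffel form (of the first kind) of the Levi-Civita connection `∇` at `p`: for constant
vector fields `v`, `w`, `a`, Koszul's formula says that `g(∇_v w, a)` is this number. -/
def christoffel (M : PseudoRiemannianMetric E) (p v w a : E) : ℝ :=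
  (1 / 2) * (fderiv ℝ (fun q => M.g q w a) p v + fderiv ℝ (fun q => M.g q v a) p w -
    fderiv ℝ (fun q => M.g q v w) p a)

/-- The curve `γ : ℝ → E` is a geodesic: `∇_{γ'} γ' = 0`, that is,
`g(γ'' + Γ(γ', γ'), a) = 0` for every vector `a`. -/
def IsGeodesic (M : PseudoRiemannianMetric E) (γ : ℝ → E) : Prop :=
  ContDiff ℝ 2 γ ∧ ∀ (r : ℝ) (a : E),
    M.g (γ r) (deriv (deriv γ) r) a + M.christoffel (γ r) (deriv γ r) (deriv γ r) a = 0

/-- Geodesic completeness: every initial condition is that of a geodesic defined on `ℝ`. -/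
def IsGeodesicallyComplete (M : PseudoRiemannianMetric E) : Prop :=
  ∀ p v : E, ∃ γ : ℝ → E, M.IsGeodesic γ ∧ γ 0 = p ∧ deriv γ 0 = v

end PseudoRiemannianMetric

/-- For `v` tangent to `G_lam` at `p`, the element `(L_{p⁻¹})_{*,p} v` of the Lie algebra. -/
def OscGroup.maurerCartan {n : ℕ} {lam : Fin n → ℝ} (p : OscGroup lam) :
    OscGroup lam →ₗ[ℝ] OscAlgebra lam :=
  (OscAlgebra.equivLie lam).symm.toLinearEquiv.toLinearMap ∘ₗ
    (fderiv ℝ (fun q : OscGroup lam => p⁻¹ * q) p).toLinearMap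

theorem OscGroup.maurerCartan_apply {n : ℕ} {lam : Fin n → ℝ} (p v : OscGroup lam) :
    p.maurerCartan v = OscAlgebra.mk (OscGroup.t (p⁻¹.dL v)) (OscGroup.s (p⁻¹.dL v))
      (OscGroup.z (p⁻¹.dL v)) := by
  rw [← OscGroup.fderiv_mul_left p⁻¹ p v]
  rfl

theorem OscGroup.maurerCartan_dL {n : ℕ} {lam : Fin n → ℝ} (p : OscGroup lam)
    (x : OscAlgebra lam) : p.maurerCartan (p.dL (OscGroup.mk x.xm x.x0 x.zc)) = x := by
  rw [OscGroup.maurerCartan_apply, OscGroup.dL_dL, inv_mul_cancel, OscGroup.dL_one]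
  rfl

/-- The left-invariant metric on `G_lam` which is `k_u(x, y) = k_lam(u x, y)` at the identity. -/
def leftInvariantMetric {n : ℕ} {lam : Fin n → ℝ} (hlam : ∀ j, 0 < lam j)
    (u : OscAlgebra lam ≃ₗ[ℝ] OscAlgebra lam)
    (hu : ∀ x y, OscAlgebra.kForm lam (u x) y = OscAlgebra.kForm lam x (u y)) :
    PseudoRiemannianMetric (OscGroup lam) where
  g p := ((OscAlgebra.kForm lam).comp u.toLinearMap LinearMap.id).comp
    p.maurerCartan p.maurerCartan
  symm p v w := by
    simp only [LinearMap.BilinForm.comp_apply, LinearEquiv.coe_coe, LinearMap.id_apply]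
    rw [hu, OscAlgebra.kForm_comm]
  nondegenerate p v hv := by
    have h1 : u (p.maurerCartan v) = 0 := by
      refine OscAlgebra.kForm_nondeg hlam _ fun y => ?_
      have h := hv (p.dL (OscGroup.mk y.xm y.x0 y.zc))
      simpa [LinearMap.BilinForm.comp_apply, OscGroup.maurerCartan_dL] using h
    have h2 : p.maurerCartan v = 0 := by simpa using h1
    rw [OscGroup.maurerCartan_apply] at h2
    have h3 : p⁻¹.dL v = 0 := h2
    have h4 : p.dL (p⁻¹.dL v) = v := by
      rw [OscGroup.dL_dL, mul_inv_cancel, OscGroup.dL_one]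
    rw [← h4, h3]
    have h5 : ∀ j, OscGroup.z (0 : OscGroup lam) j = 0 := fun _ => rfl
    refine OscGroup.ext' rfl ?_ fun j => ?_
    · simp only [OscGroup.dL, OscGroup.s_mk, h5, mul_zero, Complex.zero_im,
        Finset.sum_const_zero, add_zero]
    · simp only [OscGroup.dL, OscGroup.z_mk, h5, mul_zero]
  smooth v w := by
    let f : OscGroup lam ≃ₗ[ℝ] OscAlgebra lam := (OscAlgebra.equivLie lam).symm.toLinearEquiv
    let B : LinearMap.BilinForm ℝ (OscGroup lam) :=
      ((OscAlgebra.kForm lam).comp u.toLinearMap LinearMap.id).comp f.toLinearMap f.toLinearMap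
    have h : ∀ v : OscGroup lam, ContDiff ℝ ∞ (fun p : OscGroup lam => p⁻¹.dL v) := fun v =>
      (OscGroup.contDiff_dL v).comp OscGroup.contDiff_inv'
    have h2 : ContDiff ℝ ∞ (fun p : OscGroup lam =>
        B.toContinuousBilinearMap (p⁻¹.dL v) (p⁻¹.dL w)) :=
      (B.toContinuousBilinearMap.contDiff.comp (h v)).clm_apply (h w)
    have h3 : (fun p : OscGroup lam => B.toContinuousBilinearMap (p⁻¹.dL v) (p⁻¹.dL w)) =
        fun p : OscGroup lam => OscAlgebra.kForm lam (u (p.maurerCartan v)) (p.maurerCartan w) := by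
      funext p
      rw [OscGroup.maurerCartan_apply, OscGroup.maurerCartan_apply]
      rfl
    rw [h3] at h2
    exact h2

theorem leftInvariantMetric_apply {n : ℕ} {lam : Fin n → ℝ} (hlam : ∀ j, 0 < lam j)
    (u : OscAlgebra lam ≃ₗ[ℝ] OscAlgebra lam)
    (hu : ∀ x y, OscAlgebra.kForm lam (u x) y = OscAlgebra.kForm lam x (u y))
    (p v w : OscGroup lam) :
    (leftInvariantMetric hlam u hu).g p v w =
      OscAlgebra.kForm lam (u (p.maurerCartan v)) (p.maurerCartan w) := rfl

/-- The metric is invariant under the left translations `q ↦ h * q`. -/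
theorem leftInvariantMetric_mul_left {n : ℕ} {lam : Fin n → ℝ} (hlam : ∀ j, 0 < lam j)
    (u : OscAlgebra lam ≃ₗ[ℝ] OscAlgebra lam)
    (hu : ∀ x y, OscAlgebra.kForm lam (u x) y = OscAlgebra.kForm lam x (u y))
    (h p v w : OscGroup lam) :
    (leftInvariantMetric hlam u hu).g (h * p) (fderiv ℝ (fun q : OscGroup lam => h * q) p v)
      (fderiv ℝ (fun q : OscGroup lam => h * q) p w) =
      (leftInvariantMetric hlam u hu).g p v w := by
  have e : ∀ v : OscGroup lam, (h * p).maurerCartan (h.dL v) = p.maurerCartan v := by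
    intro v
    rw [OscGroup.maurerCartan_apply, OscGroup.maurerCartan_apply, OscGroup.dL_dL, mul_inv_rev,
      inv_mul_cancel_right]
  rw [OscGroup.fderiv_mul_left, OscGroup.fderiv_mul_left, leftInvariantMetric_apply,
    leftInvariantMetric_apply, e, e]

end

/-!
The form `k = k_lam` is bi-invariant and nondegenerate, hence the center and the derived ideal are
orthogonal to each other (`OscAlgebra.derivedSeries_one_eq_orthogonal_center`), and a `k`-symmetric
map which preserves the one preserves the other.

For completeness, let `x` be the body velocity of a curve (the value of the Maurer–Cartan form on
the velocity). The curve is a geodesic of `k_u` if and only if the momentum `y = u x` satisfies the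
Euler equation `y' = [y, u⁻¹ y]`; only the "if" is needed
(`isGeodesic_of_hasDerivAt_eulerField`). Since a curve in the group is recovered from its body
velocity by integration, it suffices to solve the Euler equation for all times.

Both assumptions on `u` imply that `u⁻¹ e₀` lies in the plane spanned by `e₀` and some `h` with
`h₋₁ = 1`, and `h` can be taken isotropic (`OscAlgebra.HasStablePlane`). If the center is stable this
holds with `h = e₋₁`; a Cartan subalgebra is such a plane. Along a solution of the Euler equation
`m = k(y, e₀)` and `C = k(y, y)` are constant. Put `η = k(y, h)` and `y = m h + η e₀ + x` with `x`
orthogonal to `h` and `e₀`; then `k(x, x) = C - 2 m η`. The form is positive definite on the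
orthogonal of `h` and `e₀`, so `‖x‖²` is bounded linearly in `|η|`. Invariance gives
`η' = -k([x, h], u⁻¹ y)`. In `u⁻¹ y = m u⁻¹ h + η u⁻¹ e₀ + u⁻¹ x` the middle term contributes nothing,
since `u⁻¹ e₀` commutes with `h`. So `η'` is quadratic in `x`, that is, `|η'| ≤ K |η| + ε`, and by
Grönwall's inequality `η`, and with it `y`, remains bounded in finite time
(`OscAlgebra.exists_norm_le_and_abs_kForm_eulerField_le`,
`OscAlgebra.exists_hasDerivAt_eulerField`).
-/

/-! ### Global solutions of autonomous differential equations -/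

open Set Metric in
/-- A compactly supported `C¹` vector field has solutions on every bounded time interval: it is
globally Lipschitz and bounded, so that Picard–Lindelöf applies with a ball of any radius. -/
theorem exists_hasDerivAt_Ioo_of_hasCompactSupport {E : Type*} [NormedAddCommGroup E]
    [NormedSpace ℝ E] [CompleteSpace E] {f : E → E} (hf : ContDiff ℝ 1 f)
    (hc : HasCompactSupport f) (x₀ : E) {T : ℝ} (hT : 0 < T) :
    ∃ γ : ℝ → E, γ 0 = x₀ ∧ ∀ t ∈ Ioo (-T) T, HasDerivAt γ (f (γ t)) t := by
  obtain ⟨K, hK⟩ := hf.lipschitzWith_of_hasCompactSupport hc (by norm_num)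
  obtain ⟨C, hC⟩ := hc.exists_bound_of_continuous hf.continuous
  have h0 : (0 : ℝ) ∈ Icc (-T) T := ⟨by linarith, hT.le⟩
  have hP : IsPicardLindelof (fun _ ↦ f) (⟨0, h0⟩ : Icc (-T) T) x₀ (C.toNNReal * T.toNNReal) 0
      C.toNNReal K := by
    refine .of_time_independent (fun x _ ↦ (hC x).trans (Real.le_coe_toNNReal C))
      hK.lipschitzOnWith ?_
    simp [hT.le]
  obtain ⟨γ, h1, h2⟩ := hP.exists_eq_forall_mem_Icc_hasDerivWithinAt₀
  exact ⟨γ, h1, fun t ht ↦ (h2 t (Ioo_subset_Icc_self ht)).hasDerivAt (Icc_mem_nhds ht.1 ht.2)⟩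

open Set Metric in
/-- Solutions on the intervals `(-T, T)` with the same initial value, each of them bounded, glue to
a global solution. -/
theorem exists_hasDerivAt_of_forall_Ioo {E : Type*} [NormedAddCommGroup E] [NormedSpace ℝ E]
    [FiniteDimensional ℝ E] {f : E → E} (hf : ContDiff ℝ 1 f) (x₀ : E)
    (h : ∀ T : ℝ, 0 < T → ∃ γ : ℝ → E, γ 0 = x₀ ∧ (∃ R, ∀ t ∈ Ioo (-T) T, ‖γ t‖ ≤ R) ∧
      ∀ t ∈ Ioo (-T) T, HasDerivAt γ (f (γ t)) t) :
    ∃ γ : ℝ → E, γ 0 = x₀ ∧ ∀ t, HasDerivAt γ (f (γ t)) t := by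
  choose! γ h0 hb hd using h
  choose! R hR using hb
  have huniq : ∀ S T : ℝ, 0 < S → S ≤ T → EqOn (γ S) (γ T) (Ioo (-S) S) := by
    intro S T hS hST
    have hsub : Ioo (-S) S ⊆ Ioo (-T) T := Ioo_subset_Ioo (by linarith) hST
    obtain ⟨K, hK⟩ := hf.contDiffOn.exists_lipschitzOnWith (by norm_num)
      (convex_closedBall (0 : E) (max (R S) (R T))) (isCompact_closedBall _ _)
    refine ODE_solution_unique_of_mem_Ioo (v := fun _ ↦ f) (fun _ _ ↦ hK) (t₀ := 0)
      ⟨by linarith, hS⟩ (fun t ht ↦ ⟨hd S hS t ht, ?_⟩)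
      (fun t ht ↦ ⟨hd T (hS.trans_le hST) t (hsub ht), ?_⟩)
      ((h0 S hS).trans (h0 T (hS.trans_le hST)).symm)
    · exact mem_closedBall_zero_iff.2 ((hR S hS t ht).trans (le_max_left _ _))
    · exact mem_closedBall_zero_iff.2
        ((hR T (hS.trans_le hST) t (hsub ht)).trans (le_max_right _ _))
  refine ⟨fun t ↦ γ (|t| + 1) t, h0 _ (by positivity), fun t ↦ ?_⟩
  have ht : t ∈ Ioo (-(|t| + 1)) (|t| + 1) := abs_lt.1 (lt_add_one _)
  refine (hd (|t| + 1) (by positivity) t ht).congr_of_eventuallyEq ?_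
  filter_upwards [Ioo_mem_nhds ht.1 ht.2] with r hr
  rcases le_total (|r| + 1) (|t| + 1) with hle | hle
  · exact huniq _ _ (by positivity) hle (abs_lt.1 (lt_add_one _))
  · exact (huniq _ _ (by positivity) hle hr).symm

open Set Metric in
/-- Global existence from an a priori bound. The bound is required of the solutions of the slowed
down equations `γ' = φ(γ) f(γ)`, `0 ≤ φ ≤ 1`: with `φ` a bump function these have solutions on
bounded intervals, and they solve `γ' = f(γ)` as soon as `φ = 1` on the ball given by the bound. -/
theorem exists_hasDerivAt_of_bounded {E : Type*} [NormedAddCommGroup E] [NormedSpace ℝ E]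
    [FiniteDimensional ℝ E] {f : E → E} (hf : ContDiff ℝ 1 f) (x₀ : E)
    (h : ∀ T : ℝ, 0 < T → ∃ R : ℝ, ∀ (φ : E → ℝ) (γ : ℝ → E), (∀ x, 0 ≤ φ x ∧ φ x ≤ 1) →
      γ 0 = x₀ → (∀ t ∈ Ioo (-T) T, HasDerivAt γ (φ (γ t) • f (γ t)) t) →
      ∀ t ∈ Ioo (-T) T, ‖γ t‖ ≤ R) :
    ∃ γ : ℝ → E, γ 0 = x₀ ∧ ∀ t, HasDerivAt γ (f (γ t)) t := by
  refine exists_hasDerivAt_of_forall_Ioo hf x₀ fun T hT ↦ ?_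
  obtain ⟨R, hR⟩ := h T hT
  let φ : ContDiffBump (0 : E) := ⟨|R| + 1, |R| + 2, by positivity, by linarith⟩
  have hφ : HasCompactSupport φ := φ.hasCompactSupport
  obtain ⟨γ, h0, hd⟩ := exists_hasDerivAt_Ioo_of_hasCompactSupport
    (φ.contDiff.smul hf) hφ.smul_right x₀ hT
  have hb := hR φ γ (fun x ↦ ⟨φ.nonneg, φ.le_one⟩) h0 hd
  refine ⟨γ, h0, ⟨R, hb⟩, fun t ht ↦ ?_⟩
  have h1 : φ (γ t) = 1 := by
    refine φ.one_of_mem_closedBall (mem_closedBall_zero_iff.2 ((hb t ht).trans ?_))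
    change R ≤ |R| + 1
    linarith [le_abs_self R]
  simpa [h1] using hd t ht

open Set in
/-- A real function with `|f'| ≤ K |f| + ε` on `(-T, T)` is bounded there, with a bound that depends
only on `f 0`. -/
theorem abs_le_gronwallBound_of_mem_Ioo {f f' : ℝ → ℝ} {K ε T : ℝ} (hK : 0 ≤ K) (hε : 0 ≤ ε)
    (hf : ∀ t ∈ Ioo (-T) T, HasDerivAt f (f' t) t)
    (hb : ∀ t ∈ Ioo (-T) T, |f' t| ≤ K * |f t| + ε) :
    ∀ t ∈ Ioo (-T) T, |f t| ≤ gronwallBound |f 0| K ε T := by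
  have key : ∀ g g' : ℝ → ℝ, (∀ t ∈ Ioo (-T) T, HasDerivAt g (g' t) t) →
      (∀ t ∈ Ioo (-T) T, |g' t| ≤ K * |g t| + ε) →
      ∀ t ∈ Ico 0 T, |g t| ≤ gronwallBound |g 0| K ε T := by
    intro g g' hg hb t ht
    have hsub : Icc 0 t ⊆ Ioo (-T) T := fun r hr ↦
      ⟨by linarith [hr.1, ht.1, ht.2], hr.2.trans_lt ht.2⟩
    have h := norm_le_gronwallBound_of_norm_deriv_right_le (f := g) (f' := g') (a := 0) (b := t)
      (fun r hr ↦ (hg r (hsub hr)).continuousAt.continuousWithinAt)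
      (fun r hr ↦ (hg r (hsub (Ico_subset_Icc_self hr))).hasDerivWithinAt) le_rfl
      (fun r hr ↦ hb r (hsub (Ico_subset_Icc_self hr))) t ⟨ht.1, le_rfl⟩
    refine h.trans (gronwallBound_mono (norm_nonneg _) hε hK ?_)
    linarith [ht.2]
  intro t ht
  rcases le_total 0 t with h0 | h0
  · exact key f f' hf hb t ⟨h0, ht.2⟩
  · have h := key (fun r ↦ f (-r)) (fun r ↦ -f' (-r)) (fun r hr ↦ ?_) (fun r hr ↦ ?_) (-t)
      ⟨by linarith, by linarith [ht.1]⟩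
    · simpa using h
    · have hr' : -r ∈ Ioo (-T) T := ⟨by linarith [hr.2], by linarith [hr.1]⟩
      exact ((hf (-r) hr').comp r (hasDerivAt_neg r)).congr_deriv (by ring)
    · have hr' : -r ∈ Ioo (-T) T := ⟨by linarith [hr.2], by linarith [hr.1]⟩
      simpa using hb (-r) hr'

/-! ### The invariant form of the oscillator algebra -/

namespace OscAlgebra

variable {n : ℕ} {lam : Fin n → ℝ}

/-- The sup norm of the coordinates; all that matters is that it defines the usual topology. -/
noncomputable instance : NormedAddCommGroup (OscAlgebra lam) :=
  inferInstanceAs (NormedAddCommGroup (ℝ × ℝ × (Fin n → ℂ)))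
noncomputable instance : NormedSpace ℝ (OscAlgebra lam) :=
  inferInstanceAs (NormedSpace ℝ (ℝ × ℝ × (Fin n → ℂ)))

@[simp] theorem xm_neg (x : OscAlgebra lam) : xm (-x) = -xm x := rfl

theorem norm_le_of_coord_le {x : OscAlgebra lam} {b : ℝ} (hb : 0 ≤ b) (h1 : |xm x| ≤ b)
    (h2 : |x0 x| ≤ b) (h3 : ∀ j, ‖zc x j‖ ≤ b) : ‖x‖ ≤ b :=
  max_le h1 (max_le h2 ((pi_norm_le_iff_of_nonneg hb).2 h3))

/-- The form is bi-invariant: `k([x, y], z) = k(x, [y, z])`. -/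
theorem kForm_lie (hlam : ∀ j, 0 < lam j) (x y z : OscAlgebra lam) :
    kForm lam ⁅x, y⁆ z = kForm lam x ⁅y, z⁆ := by
  simp only [kForm_apply, bracket_def, xm_mk, x0_mk, zc_mk, zero_mul, mul_zero, zero_add, add_zero,
    Finset.sum_mul, Finset.mul_sum, ← Finset.sum_add_distrib]
  refine Finset.sum_congr rfl fun j _ ↦ ?_
  have := (hlam j).ne'
  simp
  field_simp
  ring

theorem kForm_nondegenerate (hlam : ∀ j, 0 < lam j) : (kForm lam).Nondegenerate :=
  ⟨fun x hx ↦ kForm_nondeg hlam x hx,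
    fun x hx ↦ kForm_nondeg hlam x fun y ↦ (kForm_comm x y).trans (hx y)⟩

theorem kForm_isRefl : (kForm lam).IsRefl := fun x y h ↦ (kForm_comm y x).trans h

/-- The derived ideal is the orthogonal of the center: by invariance the orthogonal of the derived
ideal is the center. -/
theorem derivedSeries_one_eq_orthogonal_center (hlam : ∀ j, 0 < lam j) :
    (LieAlgebra.derivedSeries ℝ (OscAlgebra lam) 1).toSubmodule =
      (kForm lam).orthogonal (LieAlgebra.center ℝ (OscAlgebra lam)).toSubmodule := by
  have hD : (LieAlgebra.derivedSeries ℝ (OscAlgebra lam) 1).toSubmodule =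
      Submodule.span ℝ {⁅x, y⁆ | (x : OscAlgebra lam) (y : OscAlgebra lam)} :=
    LieAlgebra.coe_derivedSeries_one_eq ℝ (OscAlgebra lam)
  rw [← LinearMap.BilinForm.orthogonal_orthogonal (kForm_nondegenerate hlam) kForm_isRefl
    (LieAlgebra.derivedSeries ℝ (OscAlgebra lam) 1).toSubmodule]
  congr 1
  ext c
  rw [LieSubmodule.mem_toSubmodule, LieModule.mem_maxTrivSubmodule,
    LinearMap.BilinForm.mem_orthogonal_iff, hD]
  constructor
  · intro h x
    refine kForm_nondeg hlam _ fun y ↦ ?_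
    rw [kForm_comm, ← kForm_lie hlam]
    exact h _ (Submodule.subset_span ⟨y, x, rfl⟩)
  · intro h w hw
    change kForm lam w c = 0
    induction hw using Submodule.span_induction with
    | mem w hw => obtain ⟨x, y, rfl⟩ := hw; rw [kForm_lie hlam, h y, map_zero]
    | zero => simp
    | add a b _ _ ha hb => simp [ha, hb]
    | smul r a _ ha => simp [ha]

/-- A symmetric map preserving a subspace preserves its orthogonal. -/
theorem map_mem_derivedSeries_one (hlam : ∀ j, 0 < lam j)
    {u : OscAlgebra lam ≃ₗ[ℝ] OscAlgebra lam}
    (hu : ∀ x y, kForm lam (u x) y = kForm lam x (u y))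
    (hc : ∀ x ∈ LieAlgebra.center ℝ (OscAlgebra lam), u x ∈ LieAlgebra.center ℝ (OscAlgebra lam))
    {x : OscAlgebra lam} (hx : x ∈ LieAlgebra.derivedSeries ℝ (OscAlgebra lam) 1) :
    u x ∈ LieAlgebra.derivedSeries ℝ (OscAlgebra lam) 1 := by
  rw [← LieSubmodule.mem_toSubmodule, derivedSeries_one_eq_orthogonal_center hlam,
    LinearMap.BilinForm.mem_orthogonal_iff] at hx ⊢
  exact fun c h ↦ (hu c x).symm.trans (hx _ (hc c h))

/-- The central element `e₀`. -/
noncomputable def e0 : OscAlgebra lam := mk 0 1 0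

@[simp] theorem xm_e0 : xm (e0 : OscAlgebra lam) = 0 := rfl
@[simp] theorem x0_e0 : x0 (e0 : OscAlgebra lam) = 1 := rfl
@[simp] theorem zc_e0 (j : Fin n) : zc (e0 : OscAlgebra lam) j = 0 := rfl

@[simp] theorem lie_e0 (x : OscAlgebra lam) : ⁅x, (e0 : OscAlgebra lam)⁆ = 0 := by
  ext j <;> simp [bracket_def]

@[simp] theorem e0_lie (x : OscAlgebra lam) : ⁅(e0 : OscAlgebra lam), x⁆ = 0 := by
  rw [← lie_skew, lie_e0, neg_zero]

@[simp] theorem kForm_e0 (x : OscAlgebra lam) : kForm lam x e0 = xm x := by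
  simp [kForm_apply]

@[simp] theorem e0_kForm (x : OscAlgebra lam) : kForm lam e0 x = xm x := by
  rw [kForm_comm, kForm_e0]

/-- The form is positive definite, hence comparable to the square of the norm, on the orthogonal of
`h` and `e₀` as soon as `h` and `e₀` are not orthogonal. -/
theorem exists_norm_sq_le_kForm (hlam : ∀ j, 0 < lam j) (h : OscAlgebra lam) (hm : xm h = 1) :
    ∃ d : ℝ, 0 ≤ d ∧ ∀ x : OscAlgebra lam, xm x = 0 → kForm lam x h = 0 →
      0 ≤ kForm lam x x ∧ ‖x‖ ^ 2 ≤ d * kForm lam x x := by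
  set Λ : ℝ := ∑ j, lam j
  set D : ℝ := ∑ j, (1 / lam j) * ‖zc h j‖
  have hΛ : 0 ≤ Λ := Finset.sum_nonneg fun j _ ↦ (hlam j).le
  have hD : 0 ≤ D := Finset.sum_nonneg fun j _ ↦
    mul_nonneg (one_div_nonneg.2 (hlam j).le) (norm_nonneg _)
  refine ⟨(1 + D) ^ 2 * Λ, by positivity, fun x hx hxh ↦ ?_⟩
  have hF : kForm lam x x = ∑ j, (1 / lam j) * ‖zc x j‖ ^ 2 := by
    simp only [kForm_apply, hx, zero_mul, mul_zero, zero_add, ← Complex.normSq_eq_norm_sq,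
      Complex.normSq_apply]
  have hterm : ∀ j, 0 ≤ (1 / lam j) * ‖zc x j‖ ^ 2 := fun j ↦
    mul_nonneg (one_div_nonneg.2 (hlam j).le) (by positivity)
  have hF0 : 0 ≤ kForm lam x x := hF ▸ Finset.sum_nonneg fun j _ ↦ hterm j
  set S := √(Λ * kForm lam x x)
  have hz : ∀ j, ‖zc x j‖ ≤ S := fun j ↦ by
    refine Real.le_sqrt_of_sq_le ?_
    have h1 : (1 / lam j) * ‖zc x j‖ ^ 2 ≤ kForm lam x x :=
      hF ▸ Finset.single_le_sum (fun i _ ↦ hterm i) (Finset.mem_univ j)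
    have h2 : lam j ≤ Λ := Finset.single_le_sum (fun i _ ↦ (hlam i).le) (Finset.mem_univ j)
    have h3 : ‖zc x j‖ ^ 2 = lam j * ((1 / lam j) * ‖zc x j‖ ^ 2) := by
      have := (hlam j).ne'
      field_simp
    rw [h3]
    exact mul_le_mul h2 h1 (hterm j) hΛ
  have h0 : |x0 x| ≤ D * S := by
    rw [kForm_apply, hx, hm] at hxh
    have e : x0 x = -∑ j, (1 / lam j) *
        ((zc x j).re * (zc h j).re + (zc x j).im * (zc h j).im) := by linarith
    rw [e, abs_neg, Finset.sum_mul]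
    refine (Finset.abs_sum_le_sum_abs _ _).trans (Finset.sum_le_sum fun j _ ↦ ?_)
    have h1 : (zc x j).re * (zc h j).re + (zc x j).im * (zc h j).im =
        ((starRingEnd ℂ) (zc h j) * zc x j).re := by simp; ring
    rw [h1, abs_mul, abs_of_nonneg (one_div_nonneg.2 (hlam j).le), mul_assoc]
    refine mul_le_mul_of_nonneg_left ?_ (one_div_nonneg.2 (hlam j).le)
    refine (Complex.abs_re_le_norm _).trans ?_
    rw [norm_mul, RCLike.norm_conj]
    exact mul_le_mul_of_nonneg_left (hz j) (norm_nonneg _)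
  have hS : 0 ≤ S := Real.sqrt_nonneg _
  have hnorm : ‖x‖ ≤ (1 + D) * S := by
    refine norm_le_of_coord_le (by positivity) ?_ (h0.trans ?_) fun j ↦ (hz j).trans ?_
    · rw [hx, abs_zero]; positivity
    · linarith
    · nlinarith
  refine ⟨hF0, ?_⟩
  calc ‖x‖ ^ 2 ≤ ((1 + D) * S) ^ 2 := pow_le_pow_left₀ (norm_nonneg _) hnorm 2
    _ = (1 + D) ^ 2 * Λ * kForm lam x x := by
      rw [mul_pow, Real.sq_sqrt (mul_nonneg hΛ hF0), mul_assoc]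

end OscAlgebra

/-! ### Stable centers and stable Cartan subalgebras -/

/-- An automorphism of a finite-dimensional space which maps a subspace into itself maps it onto
itself. -/
theorem LinearEquiv.symm_mem_of_forall_mem {K V : Type*} [DivisionRing K] [AddCommGroup V]
    [Module K V] [FiniteDimensional K V] (u : V ≃ₗ[K] V) {W : Submodule K V}
    (h : ∀ x ∈ W, u x ∈ W) {x : V} (hx : x ∈ W) : u.symm x ∈ W := by
  have e : W.map u.toLinearMap = W :=
    Submodule.eq_of_le_of_finrank_eq (Submodule.map_le_iff_le_comap.2 h) (u.finrank_map_eq W)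
  rw [← e] at hx
  obtain ⟨y, hy, rfl⟩ := hx
  simpa using hy

namespace OscAlgebra

variable {n : ℕ} {lam : Fin n → ℝ}

theorem e0_mem_center : (e0 : OscAlgebra lam) ∈ LieAlgebra.center ℝ (OscAlgebra lam) :=
  (LieModule.mem_maxTrivSubmodule _ _ _ _).2 lie_e0

theorem zc_eq_zero_of_mem_center (hlam : ∀ j, 0 < lam j) {x : OscAlgebra lam}
    (hx : x ∈ LieAlgebra.center ℝ (OscAlgebra lam)) (j : Fin n) : zc x j = 0 := by
  have h := congrArg (fun y ↦ zc y j) ((LieModule.mem_maxTrivSubmodule _ _ _ _).1 hx (mk 1 0 0))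
  simpa [bracket_def, (hlam j).ne'] using h

/-- Some plane spanned by `e₀` and an isotropic vector `h` with `k(h, e₀) = 1` contains `u⁻¹ e₀`.
This is the one property of `u` which completeness depends on. -/
def HasStablePlane (u : OscAlgebra lam ≃ₗ[ℝ] OscAlgebra lam) : Prop :=
  ∃ (h : OscAlgebra lam) (α β : ℝ), xm h = 1 ∧ kForm lam h h = 0 ∧
    u.symm e0 = α • h + β • e0

/-- Only the nonvanishing of `k(h, e₀)` matters: `h` becomes isotropic when a suitable multiple of
`e₀` is added. -/
theorem hasStablePlane_of_symm_e0_eq {u : OscAlgebra lam ≃ₗ[ℝ] OscAlgebra lam}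
    {h : OscAlgebra lam} {α β : ℝ} (hm : xm h = 1) (he : u.symm e0 = α • h + β • e0) :
    HasStablePlane u := by
  refine ⟨h + (-(kForm lam h h / 2)) • e0, α, β + α * (kForm lam h h / 2), ?_, ?_, ?_⟩
  · simp [hm]
  · simp [hm]
    ring
  · rw [he]
    module

theorem hasStablePlane_of_center_stable (hlam : ∀ j, 0 < lam j)
    {u : OscAlgebra lam ≃ₗ[ℝ] OscAlgebra lam}
    (hc : ∀ x ∈ LieAlgebra.center ℝ (OscAlgebra lam),
      u x ∈ LieAlgebra.center ℝ (OscAlgebra lam)) : HasStablePlane u := by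
  have h1 : u.symm e0 ∈ LieAlgebra.center ℝ (OscAlgebra lam) :=
    u.symm_mem_of_forall_mem (W := (LieAlgebra.center ℝ (OscAlgebra lam)).toSubmodule) hc
      e0_mem_center
  refine hasStablePlane_of_symm_e0_eq (h := mk 1 0 0) (α := xm (u.symm e0))
    (β := x0 (u.symm e0)) rfl ?_
  ext j
  · simp
  · simp
  · simp [zc_eq_zero_of_mem_center hlam h1]

theorem e0_mem_of_isCartanSubalgebra (H : LieSubalgebra ℝ (OscAlgebra lam))
    [H.IsCartanSubalgebra] : (e0 : OscAlgebra lam) ∈ H := by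
  rw [← LieSubalgebra.IsCartanSubalgebra.self_normalizing (H := H),
    LieSubalgebra.mem_normalizer_iff]
  intro y _
  simp

/-- A Cartan subalgebra is not contained in the hyperplane `x₋₁ = 0`. In that hyperplane all
brackets are multiples of `e₀`, so the Cartan subalgebra would be the whole hyperplane; but this is
an ideal, and an ideal is its own normalizer only if it is everything. -/
theorem exists_mem_xm_eq_one_of_isCartanSubalgebra (H : LieSubalgebra ℝ (OscAlgebra lam))
    [H.IsCartanSubalgebra] : ∃ h ∈ H, xm h = 1 := by
  have hn : H.normalizer = H := LieSubalgebra.IsCartanSubalgebra.self_normalizing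
  have he := e0_mem_of_isCartanSubalgebra H
  by_contra! hne
  have h0 : ∀ x ∈ H, xm x = 0 := by
    intro x hx
    by_contra hxm
    refine hne ((xm x)⁻¹ • x) (H.smul_mem _ hx) ?_
    simp [hxm]
  have hall : ∀ x : OscAlgebra lam, xm x = 0 → x ∈ H := by
    intro x hx
    rw [← hn, LieSubalgebra.mem_normalizer_iff]
    intro y hy
    have e : ⁅x, y⁆ = x0 ⁅x, y⁆ • (e0 : OscAlgebra lam) := by
      ext j <;> simp [bracket_def, hx, h0 y hy]
    rw [e]
    exact H.smul_mem _ he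
  refine hne (mk 1 0 0) ?_ rfl
  rw [← hn, LieSubalgebra.mem_normalizer_iff]
  exact fun y _ ↦ hall _ rfl

/-- If `h₋₁ = 1`, then `ad h` multiplies the complex coordinates of `x - x₋₁ h` by the `i lam_j`, so
that it is nilpotent only where these coordinates vanish. -/
theorem zc_ad_pow_succ (H : LieSubalgebra ℝ (OscAlgebra lam)) {h : H} (hm : xm h.1 = 1) (x : H)
    (k : ℕ) : xm (((LieAlgebra.ad ℝ H h ^ (k + 1)) x : H) : OscAlgebra lam) = 0 ∧
      ∀ j, zc (((LieAlgebra.ad ℝ H h ^ (k + 1)) x : H) : OscAlgebra lam) j =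
        (Complex.I * lam j) ^ (k + 1) * (zc x.1 j - xm x.1 * zc h.1 j) := by
  induction k with
  | zero => simp [bracket_def, hm]
  | succ k ih =>
    rw [pow_succ', Module.End.mul_apply, LieAlgebra.ad_apply, LieSubalgebra.coe_bracket,
      bracket_def]
    refine ⟨rfl, fun j ↦ ?_⟩
    rw [zc_mk, ih.1, ih.2, hm]
    push_cast
    ring

/-- A Cartan subalgebra is spanned by `e₀` and any of its elements `h` with `h₋₁ = 1`. -/
theorem eq_smul_add_smul_of_mem_isCartanSubalgebra (hlam : ∀ j, 0 < lam j)
    (H : LieSubalgebra ℝ (OscAlgebra lam)) [H.IsCartanSubalgebra] {h x : OscAlgebra lam}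
    (hh : h ∈ H) (hm : xm h = 1) (hx : x ∈ H) :
    x = xm x • h + (x0 x - xm x * x0 h) • e0 := by
  obtain ⟨k, hk⟩ := LieAlgebra.nilpotent_ad_of_nilpotent_algebra ℝ H
  have hz : ∀ j, zc x j = xm x * zc h j := by
    intro j
    have h1 := (zc_ad_pow_succ H (h := ⟨h, hh⟩) hm ⟨x, hx⟩ k).2 j
    rw [pow_succ', hk, mul_zero] at h1
    have h2 : (Complex.I * lam j) ^ (k + 1) ≠ 0 :=
      pow_ne_zero _ (mul_ne_zero Complex.I_ne_zero (Complex.ofReal_ne_zero.2 (hlam j).ne'))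
    exact sub_eq_zero.1 ((mul_eq_zero.1 h1.symm).resolve_left h2)
  ext j
  · simp [hm]
  · simp
  · simp [hz]

theorem hasStablePlane_of_isCartanSubalgebra (hlam : ∀ j, 0 < lam j)
    {u : OscAlgebra lam ≃ₗ[ℝ] OscAlgebra lam} (H : LieSubalgebra ℝ (OscAlgebra lam))
    [H.IsCartanSubalgebra] (hH : ∀ x ∈ H, u x ∈ H) : HasStablePlane u := by
  obtain ⟨h, hh, hm⟩ := exists_mem_xm_eq_one_of_isCartanSubalgebra H
  exact hasStablePlane_of_symm_e0_eq hm (eq_smul_add_smul_of_mem_isCartanSubalgebra hlam H hh hm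
    (u.symm_mem_of_forall_mem (W := H.toSubmodule) hH (e0_mem_of_isCartanSubalgebra H)))

end OscAlgebra

/-! ### The Euler equation -/

theorem LinearMap.BilinForm.exists_abs_le {E : Type*} [NormedAddCommGroup E]
    [NormedSpace ℝ E] [FiniteDimensional ℝ E] (B : LinearMap.BilinForm ℝ E) :
    ∃ c : ℝ, 0 ≤ c ∧ ∀ x y, |B x y| ≤ c * ‖x‖ * ‖y‖ :=
  ⟨‖B.toContinuousBilinearMap‖, ContinuousLinearMap.opNorm_nonneg _,
    fun x y ↦ B.toContinuousBilinearMap.le_opNorm₂ x y⟩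

namespace OscAlgebra

variable {n : ℕ} {lam : Fin n → ℝ}

/-- The Euler vector field `y ↦ [y, u⁻¹ y]` on the Lie algebra, which the momentum `y = u x` of a
geodesic with body velocity `x` follows. -/
noncomputable def eulerField (u : OscAlgebra lam ≃ₗ[ℝ] OscAlgebra lam) (y : OscAlgebra lam) :
    OscAlgebra lam :=
  ⁅y, u.symm y⁆

/-- The bracket as a continuous bilinear map. -/
noncomputable def bracketCLM (lam : Fin n → ℝ) :
    OscAlgebra lam →L[ℝ] OscAlgebra lam →L[ℝ] OscAlgebra lam :=
  LinearMap.toContinuousLinearMap (LinearMap.toContinuousLinearMap.toLinearMap ∘ₗ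
    (LieModule.toEnd ℝ (OscAlgebra lam) (OscAlgebra lam) :
      OscAlgebra lam →ₗ[ℝ] Module.End ℝ (OscAlgebra lam)))

theorem contDiff_eulerField (u : OscAlgebra lam ≃ₗ[ℝ] OscAlgebra lam) {k : WithTop ℕ∞} :
    ContDiff ℝ k (eulerField u) :=
  ((bracketCLM lam).contDiff.clm_apply
    u.symm.toLinearMap.toContinuousLinearMap.contDiff : ContDiff ℝ k _)

theorem hasDerivAt_kForm {x y : ℝ → OscAlgebra lam} {x' y' : OscAlgebra lam} {t : ℝ}
    (hx : HasDerivAt x x' t) (hy : HasDerivAt y y' t) :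
    HasDerivAt (fun r ↦ kForm lam (x r) (y r)) (kForm lam (x t) y' + kForm lam x' (y t)) t :=
  (kForm lam).toContinuousBilinearMap.hasDerivAt_of_bilinear (fun _ ↦ hx) (fun _ ↦ hy)

/-- The product of the momentum with `e₀` is constant. -/
theorem kForm_eulerField_e0 (u : OscAlgebra lam ≃ₗ[ℝ] OscAlgebra lam) (y : OscAlgebra lam) :
    kForm lam (eulerField u y) e0 = 0 := by
  simp [eulerField, bracket_def]

/-- The square of the momentum is constant. -/
theorem kForm_self_eulerField (hlam : ∀ j, 0 < lam j) (u : OscAlgebra lam ≃ₗ[ℝ] OscAlgebra lam)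
    (y : OscAlgebra lam) : kForm lam y (eulerField u y) = 0 := by
  rw [eulerField, ← kForm_lie hlam, lie_self, map_zero, LinearMap.zero_apply]

/-- For `h` in a stable plane the derivative of `k(y, h)` along the Euler field does not involve the
component of `u⁻¹ y` along `u⁻¹ e₀`, which lies in the plane and therefore commutes with `h`. -/
theorem kForm_eulerField (hlam : ∀ j, 0 < lam j) {u : OscAlgebra lam ≃ₗ[ℝ] OscAlgebra lam}
    {h : OscAlgebra lam} {α β : ℝ} (he : u.symm e0 = α • h + β • e0) (m η : ℝ)
    (x : OscAlgebra lam) :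
    kForm lam (eulerField u (m • h + η • e0 + x)) h =
      -(m * kForm lam ⁅x, h⁆ (u.symm h) + kForm lam ⁅x, h⁆ (u.symm x)) := by
  -- `[x, h]` is orthogonal to `h` and to the center.
  have h1 : kForm lam ⁅x, h⁆ h = 0 := by rw [kForm_lie hlam, lie_self, map_zero]
  rw [eulerField, kForm_lie hlam, ← lie_skew, map_neg, ← kForm_lie hlam]
  have h2 : ⁅m • h + η • e0 + x, h⁆ = ⁅x, h⁆ := by simp
  have h3 : kForm lam ⁅x, h⁆ e0 = 0 := by simp [bracket_def]
  simp only [h2, map_add, map_smul, he, h1, h3, smul_eq_mul, mul_zero, add_zero]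

/-- Orthogonal decomposition with respect to the hyperbolic plane spanned by `h` and `e₀`. -/
theorem exists_eq_smul_add_smul_add {h : OscAlgebra lam} (hm : xm h = 1) (hh : kForm lam h h = 0)
    (y : OscAlgebra lam) : ∃ x : OscAlgebra lam, y = xm y • h + kForm lam y h • e0 + x ∧
      xm x = 0 ∧ kForm lam x h = 0 ∧ kForm lam y y = 2 * xm y * kForm lam y h + kForm lam x x := by
  have hc := kForm_comm h y
  refine ⟨y + (-xm y) • h + (-kForm lam y h) • e0, by module, by simp [hm], ?_, ?_⟩
  · simp [hm, hh]
  · simp [hm, hh, hc]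
    ring

/-- On a common level set of the two conserved quantities, the component `x` of `y` orthogonal to
the stable plane satisfies `k(x, x) = C - 2 m k(y, h)`. So both `y` and the derivative of `k(y, h)`,
which is quadratic in `x`, grow at most linearly in `k(y, h)`. -/
theorem exists_norm_le_and_abs_kForm_eulerField_le (hlam : ∀ j, 0 < lam j)
    {u : OscAlgebra lam ≃ₗ[ℝ] OscAlgebra lam} {h : OscAlgebra lam} {α β : ℝ} (hm : xm h = 1)
    (hh : kForm lam h h = 0) (he : u.symm e0 = α • h + β • e0) (m C : ℝ) :
    ∃ K ε : ℝ, 0 ≤ K ∧ 0 ≤ ε ∧ ∀ y : OscAlgebra lam, xm y = m → kForm lam y y = C →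
      ‖y‖ ≤ K * |kForm lam y h| + ε ∧
      |kForm lam (eulerField u y) h| ≤ K * |kForm lam y h| + ε := by
  obtain ⟨d, hd, hpos⟩ := exists_norm_sq_le_kForm hlam h hm
  obtain ⟨c, hc, hB⟩ := LinearMap.BilinForm.exists_abs_le
    ((kForm lam).compl₁₂ ((bracketCLM lam).flip h).toLinearMap u.symm.toLinearMap)
  set E := ‖(e0 : OscAlgebra lam)‖
  set c' := |m| * c * ‖h‖ + c
  have hc' : 0 ≤ c' := by positivity
  -- `K` and `ε` are the sums of the constants for the two bounds.
  refine ⟨(E + d * (2 * |m|)) + c' * d * (2 * |m|), (|m| * ‖h‖ + 1 + d * |C|) +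
    (|m| * c * ‖h‖ + c' * d * |C|), by positivity, by positivity, fun y hym hyC ↦ ?_⟩
  obtain ⟨x, hy, hxm, hxh, hyy⟩ := exists_eq_smul_add_smul_add hm hh y
  set η := kForm lam y h
  rw [hym] at hy hyy
  obtain ⟨hF0, hxn⟩ := hpos x hxm hxh
  have hF : kForm lam x x ≤ |C| + 2 * |m| * |η| := by
    have h1 : kForm lam x x = C - 2 * (m * η) := by linarith
    have h2 := neg_abs_le (m * η)
    rw [abs_mul] at h2
    linarith [le_abs_self C]
  have hx2 : ‖x‖ ^ 2 ≤ d * |C| + d * (2 * |m|) * |η| :=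
    hxn.trans ((mul_le_mul_of_nonneg_left hF hd).trans_eq (by ring))
  have hx1 : ‖x‖ ≤ 1 + ‖x‖ ^ 2 := by nlinarith [sq_nonneg (‖x‖ - 1), sq_nonneg ‖x‖]
  have hη : 0 ≤ |η| := abs_nonneg _
  constructor
  · have h1 : ‖y‖ ≤ |m| * ‖h‖ + |η| * E + ‖x‖ := by
      conv_lhs => rw [hy]
      refine (norm_add_le _ _).trans (add_le_add_left ((norm_add_le _ _).trans_eq ?_) _)
      rw [norm_smul, norm_smul, Real.norm_eq_abs, Real.norm_eq_abs]
    have h2 : 0 ≤ c' * d * (2 * |m|) * |η| := by positivity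
    have h3 : 0 ≤ |m| * c * ‖h‖ + c' * d * |C| := by positivity
    linarith
  · conv_lhs => rw [hy]
    rw [kForm_eulerField hlam he, abs_neg]
    have h1 : |kForm lam ⁅x, h⁆ (u.symm h)| ≤ c * ‖x‖ * ‖h‖ := hB x h
    have h2 : |kForm lam ⁅x, h⁆ (u.symm x)| ≤ c * ‖x‖ * ‖x‖ := hB x x
    have h3 : |m| * (c * ‖x‖ * ‖h‖) ≤ |m| * c * ‖h‖ * (1 + ‖x‖ ^ 2) := by
      rw [show |m| * (c * ‖x‖ * ‖h‖) = |m| * c * ‖h‖ * ‖x‖ by ring]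
      exact mul_le_mul_of_nonneg_left hx1 (by positivity)
    have h4 := mul_le_mul_of_nonneg_left hx2 hc'
    have h5 : 0 ≤ (E + d * (2 * |m|)) * |η| := by positivity
    have h6 : 0 ≤ |m| * ‖h‖ + 1 + d * |C| := by positivity
    refine (abs_add_le _ _).trans ?_
    rw [abs_mul]
    have h7 := mul_le_mul_of_nonneg_left h1 (abs_nonneg m)
    simp only [c'] at h4 ⊢
    linarith

/-- The Euler equation has global solutions. The a priori bound survives slowing down the equation
by a factor in `[0, 1]`, which multiplies all derivatives by that factor. -/
theorem exists_hasDerivAt_eulerField (hlam : ∀ j, 0 < lam j)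
    {u : OscAlgebra lam ≃ₗ[ℝ] OscAlgebra lam} (hP : HasStablePlane u) (y₀ : OscAlgebra lam) :
    ∃ y : ℝ → OscAlgebra lam, y 0 = y₀ ∧ ∀ t, HasDerivAt y (eulerField u (y t)) t := by
  obtain ⟨h, α, β, hm, hh, he⟩ := hP
  obtain ⟨K, ε, hK, hε, hb⟩ := exists_norm_le_and_abs_kForm_eulerField_le hlam hm hh he
    (xm y₀) (kForm lam y₀ y₀)
  refine exists_hasDerivAt_of_bounded (contDiff_eulerField u) y₀ fun T _ ↦
    ⟨K * gronwallBound |kForm lam y₀ h| K ε T + ε, fun φ γ hφ h0 hd ↦ ?_⟩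
  have hlin : ∀ c : OscAlgebra lam, ∀ t ∈ Set.Ioo (-T) T, HasDerivAt (fun r ↦ kForm lam (γ r) c)
      (φ (γ t) * kForm lam (eulerField u (γ t)) c) t := fun c t ht ↦
    (hasDerivAt_kForm (hd t ht) (hasDerivAt_const t c)).congr_deriv (by simp)
  have hconst : ∀ f : ℝ → ℝ, (∀ t ∈ Set.Ioo (-T) T, HasDerivAt f 0 t) →
      ∀ t ∈ Set.Ioo (-T) T, f t = f 0 := by
    intro f hf t ht
    have h1 := abs_le_gronwallBound_of_mem_Ioo (f := fun t ↦ f t - f 0) (f' := fun _ ↦ 0) le_rfl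
      le_rfl (fun t ht ↦ (hf t ht).sub_const _) (fun t _ ↦ by simp) t ht
    rw [gronwallBound_ε0] at h1
    simpa [sub_eq_zero] using h1
  have hxm : ∀ t ∈ Set.Ioo (-T) T, xm (γ t) = xm y₀ := fun t ht ↦ by
    have h1 := hconst (fun r ↦ kForm lam (γ r) e0) (fun r hr ↦ (hlin e0 r hr).congr_deriv
      (by rw [kForm_eulerField_e0, mul_zero])) t ht
    simpa [h0] using h1
  have hC : ∀ t ∈ Set.Ioo (-T) T, kForm lam (γ t) (γ t) = kForm lam y₀ y₀ := fun t ht ↦ by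
    have h1 := hconst (fun r ↦ kForm lam (γ r) (γ r)) (fun r hr ↦
      (hasDerivAt_kForm (hd r hr) (hd r hr)).congr_deriv (by
        rw [kForm_comm (φ (γ r) • _), map_smul, kForm_self_eulerField hlam, smul_zero,
          add_zero])) t ht
    simpa only [h0] using h1
  intro t ht
  have hη := abs_le_gronwallBound_of_mem_Ioo hK hε (hlin h) (fun r hr ↦ ?_) t ht
  · rw [h0] at hη
    exact (hb _ (hxm t ht) (hC t ht)).1.trans
      (add_le_add_left (mul_le_mul_of_nonneg_left hη hK) ε)
  · rw [abs_mul, abs_of_nonneg (hφ _).1]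
    exact (mul_le_of_le_one_left (abs_nonneg _) (hφ _).2).trans (hb _ (hxm r hr) (hC r hr)).2

end OscAlgebra

/-! ### The Maurer–Cartan form -/

namespace OscAlgebra

variable {n : ℕ} {lam : Fin n → ℝ}

theorem hasDerivAt_mk {a b : ℝ → ℝ} {c : ℝ → Fin n → ℂ} {a' b' x : ℝ} {c' : Fin n → ℂ}
    (ha : HasDerivAt a a' x) (hb : HasDerivAt b b' x)
    (hc : ∀ j, HasDerivAt (fun r => c r j) (c' j) x) :
    HasDerivAt (fun r => mk (lam := lam) (a r) (b r) (c r)) (mk a' b' c') x :=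
  (HasDerivAt.prodMk ha (HasDerivAt.prodMk hb (hasDerivAt_pi.2 hc)) :
    HasDerivAt (fun r => ((a r, b r, c r) : ℝ × ℝ × (Fin n → ℂ))) (a', b', c') x)

end OscAlgebra

namespace OscGroup

variable {n : ℕ} {lam : Fin n → ℝ}

theorem hasDerivAt_t {γ : ℝ → OscGroup lam} {γ' : OscGroup lam} {r : ℝ} (h : HasDerivAt γ γ' r) :
    HasDerivAt (fun r ↦ t (γ r)) (t γ') r :=
  (ContinuousLinearMap.fst ℝ ℝ (ℝ × (Fin n → ℂ))).hasFDerivAt.comp_hasDerivAt r h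

theorem hasDerivAt_s {γ : ℝ → OscGroup lam} {γ' : OscGroup lam} {r : ℝ} (h : HasDerivAt γ γ' r) :
    HasDerivAt (fun r ↦ s (γ r)) (s γ') r :=
  ((ContinuousLinearMap.fst ℝ ℝ (Fin n → ℂ)).comp
    (ContinuousLinearMap.snd ℝ ℝ (ℝ × (Fin n → ℂ)))).hasFDerivAt.comp_hasDerivAt r h

theorem hasDerivAt_z {γ : ℝ → OscGroup lam} {γ' : OscGroup lam} {r : ℝ} (h : HasDerivAt γ γ' r)
    (j : Fin n) : HasDerivAt (fun r ↦ z (γ r) j) (z γ' j) r :=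
  hasDerivAt_pi.1 (((ContinuousLinearMap.snd ℝ ℝ (Fin n → ℂ)).comp
    (ContinuousLinearMap.snd ℝ ℝ (ℝ × (Fin n → ℂ)))).hasFDerivAt.comp_hasDerivAt r h) j

theorem hasDerivAt_rot {a : ℝ → ℝ} {a' r : ℝ} (h : HasDerivAt a a' r) (j : Fin n) :
    HasDerivAt (fun r ↦ rot lam (a r) j) (Complex.I * (a' * lam j) * rot lam (a r) j) r :=
  ((h.ofReal_comp.mul_const (lam j : ℂ)).const_mul Complex.I).cexp.congr_deriv
    (by rw [rot]; ring)

theorem hasDerivAt_im_conj_mul {f g : ℝ → ℂ} {f' g' : ℂ} {r : ℝ} (hf : HasDerivAt f f' r)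
    (hg : HasDerivAt g g' r) : HasDerivAt (fun r ↦ ((starRingEnd ℂ) (f r) * g r).im)
      (((starRingEnd ℂ) f' * g r).im + ((starRingEnd ℂ) (f r) * g').im) r := by
  have h1 : HasDerivAt (fun r ↦ (starRingEnd ℂ) (f r)) ((starRingEnd ℂ) f') r :=
    Complex.conjCLE.toContinuousLinearMap.hasFDerivAt.comp_hasDerivAt r hf
  exact (Complex.imCLM.hasFDerivAt.comp_hasDerivAt r (h1.mul hg)).congr_deriv
    (Complex.add_im _ _)

theorem maurerCartan_eq (p v : OscGroup lam) :
    p.maurerCartan v = OscAlgebra.mk (t v)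
      (s v - (1 / 2) * ∑ j, ((starRingEnd ℂ) (z p j) * z v j).im)
      (fun j ↦ rot lam (-t p) j * z v j) := by
  rw [maurerCartan_apply]
  refine OscAlgebra.ext' rfl ?_ fun j ↦ rfl
  have h : ∀ j, (starRingEnd ℂ) (-(rot lam (-t p) j * z p j)) * rot lam (-t p) j * z v j =
      -((starRingEnd ℂ) (z p j) * z v j) := by
    intro j
    rw [map_neg, map_mul, conj_rot, neg_neg]
    linear_combination -((starRingEnd ℂ) (z p j) * z v j) * rot_neg_mul (lam := lam) (t p) j
  simp only [dL, inv_def, OscAlgebra.x0_mk, s_mk, t_mk, z_mk, h, Complex.neg_im,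
    Finset.sum_neg_distrib]
  ring

/-- The derivative at `p` in the direction `b` of the Maurer–Cartan form, applied to `v`. -/
noncomputable def dMaurerCartan (p b v : OscGroup lam) : OscAlgebra lam :=
  OscAlgebra.mk 0 (-((1 / 2) * ∑ j, ((starRingEnd ℂ) (z b j) * z v j).im))
    (fun j ↦ -(Complex.I * (t b * lam j) * rot lam (-t p) j * z v j))

theorem hasDerivAt_maurerCartan {γ w : ℝ → OscGroup lam} {γ' w' : OscGroup lam} {r : ℝ}
    (hγ : HasDerivAt γ γ' r) (hw : HasDerivAt w w' r) :
    HasDerivAt (fun r ↦ (γ r).maurerCartan (w r))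
      ((γ r).maurerCartan w' + dMaurerCartan (γ r) γ' (w r)) r := by
  simp only [maurerCartan_eq]
  refine (OscAlgebra.hasDerivAt_mk (hasDerivAt_t hw) ((hasDerivAt_s hw).sub
    ((HasDerivAt.fun_sum fun j _ ↦ hasDerivAt_im_conj_mul (hasDerivAt_z hγ j)
      (hasDerivAt_z hw j)).const_mul (1 / 2 : ℝ)))
    fun j ↦ (hasDerivAt_rot (hasDerivAt_t hγ).neg j).mul (hasDerivAt_z hw j)).congr_deriv ?_
  refine OscAlgebra.ext' ?_ ?_ fun j ↦ ?_
  · simp [dMaurerCartan]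
  · simp only [dMaurerCartan, OscAlgebra.x0_add, OscAlgebra.x0_mk, Finset.sum_add_distrib]
    ring
  · simp only [dMaurerCartan, OscAlgebra.zc_add, OscAlgebra.zc_mk, Pi.neg_apply]
    push_cast
    ring

/-- The structure equation `dθ(b, v) = -[θ(b), θ(v)]` of the Maurer–Cartan form `θ`. -/
theorem dMaurerCartan_sub (p b v : OscGroup lam) :
    dMaurerCartan p b v - dMaurerCartan p v b = -⁅p.maurerCartan b, p.maurerCartan v⁆ := by
  rw [sub_eq_iff_eq_add, neg_add_eq_sub, eq_sub_iff_add_eq]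
  have hrot : ∀ j, (starRingEnd ℂ) (rot lam (-t p) j * z b j) * (rot lam (-t p) j * z v j) =
      (starRingEnd ℂ) (z b j) * z v j := by
    intro j
    rw [map_mul, conj_rot, neg_neg]
    linear_combination ((starRingEnd ℂ) (z b j) * z v j) * rot_neg_mul (lam := lam) (t p) j
  simp only [maurerCartan_eq, OscAlgebra.bracket_def]
  refine OscAlgebra.ext' ?_ ?_ fun j ↦ ?_
  · simp [dMaurerCartan]
  · simp only [dMaurerCartan, OscAlgebra.x0_add, OscAlgebra.x0_mk, OscAlgebra.zc_mk,
      Finset.mul_sum, ← Finset.sum_neg_distrib, ← Finset.sum_add_distrib]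
    refine Finset.sum_congr rfl fun j _ ↦ ?_
    have h := congrArg Complex.im (hrot j)
    rw [Complex.mul_im, Complex.conj_re, Complex.conj_im] at h
    have h2 : ((starRingEnd ℂ) (z v j) * z b j).im = -((starRingEnd ℂ) (z b j) * z v j).im := by
      simp; ring
    rw [h2]
    linarith
  · simp only [dMaurerCartan, OscAlgebra.zc_add, OscAlgebra.zc_mk, OscAlgebra.xm_mk]
    ring

end OscGroup

/-! ### Geodesics of left-invariant metrics -/

section Geodesic

variable {n : ℕ} {lam : Fin n → ℝ} (hlam : ∀ j, 0 < lam j)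
  (u : OscAlgebra lam ≃ₗ[ℝ] OscAlgebra lam)
  (hu : ∀ x y, OscAlgebra.kForm lam (u x) y = OscAlgebra.kForm lam x (u y))

open OscAlgebra OscGroup

theorem fderiv_leftInvariantMetric (p v w a : OscGroup lam) :
    fderiv ℝ (fun q ↦ (leftInvariantMetric hlam u hu).g q w a) p v =
      kForm lam (u (dMaurerCartan p v w)) (p.maurerCartan a) +
      kForm lam (u (p.maurerCartan w)) (dMaurerCartan p v a) := by
  have hd : DifferentiableAt ℝ (fun q ↦ (leftInvariantMetric hlam u hu).g q w a) p :=
    ((leftInvariantMetric hlam u hu).smooth w a).differentiable (by norm_num) p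
  have hline : HasDerivAt (fun c : ℝ ↦ p + c • v) v 0 := by
    simpa using ((hasDerivAt_id (0 : ℝ)).smul_const v).const_add p
  have hmc : ∀ b : OscGroup lam, HasDerivAt (fun c : ℝ ↦ (p + c • v).maurerCartan b)
      (dMaurerCartan p v b) 0 := fun b ↦
    (hasDerivAt_maurerCartan hline (hasDerivAt_const 0 b)).congr_deriv (by simp)
  have hu' : HasDerivAt (fun c : ℝ ↦ u ((p + c • v).maurerCartan w)) (u (dMaurerCartan p v w)) 0 :=
    u.toLinearMap.toContinuousLinearMap.hasFDerivAt.comp_hasDerivAt 0 (hmc w)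
  refine (hd.hasFDerivAt.hasLineDerivAt v).unique
    ((hasDerivAt_kForm hu' (hmc a)).congr_deriv ?_)
  simp [add_comm]

/-- The geodesic equation is the Euler equation for the body velocity: if `x` is the value of the
Maurer–Cartan form on `γ'`, its covariant acceleration pairs with `a` to
`k(u x' - [u x, x], θ(a))`. -/
theorem isGeodesic_of_hasDerivAt_eulerField {γ : ℝ → OscGroup lam} {y : ℝ → OscAlgebra lam}
    (hγ : ContDiff ℝ 2 γ) (hy : ∀ r, HasDerivAt y (eulerField u (y r)) r)
    (hγy : ∀ r, (γ r).maurerCartan (deriv γ r) = u.symm (y r)) :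
    (leftInvariantMetric hlam u hu).IsGeodesic γ := by
  refine ⟨hγ, fun r a ↦ ?_⟩
  have h1 : HasDerivAt γ (deriv γ r) r := (hγ.differentiable (by norm_num) r).hasDerivAt
  have hγ1 : ContDiff ℝ 1 (deriv γ) := hγ.deriv'
  have h2 : HasDerivAt (deriv γ) (deriv (deriv γ) r) r :=
    (hγ1.differentiable (by norm_num) r).hasDerivAt
  set w := deriv γ r
  have h3 := hasDerivAt_maurerCartan h1 h2
  simp only [hγy] at h3
  have h4 : HasDerivAt (fun r ↦ u.symm (y r)) (u.symm (eulerField u (y r))) r :=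
    u.symm.toLinearMap.toContinuousLinearMap.hasFDerivAt.comp_hasDerivAt r (hy r)
  have h5 := congrArg u (h3.unique h4)
  rw [map_add, LinearEquiv.apply_symm_apply, eulerField, ← hγy r] at h5
  have hyr : y r = u ((γ r).maurerCartan w) := by rw [hγy r, LinearEquiv.apply_symm_apply]
  rw [hyr] at h5
  have h6 := congrArg (fun x ↦ kForm lam x ((γ r).maurerCartan a)) h5
  simp only [map_add, LinearMap.add_apply, kForm_lie hlam] at h6
  have h7 := congrArg (kForm lam (u ((γ r).maurerCartan w))) (dMaurerCartan_sub (γ r) w a)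
  rw [map_sub, map_neg] at h7
  rw [PseudoRiemannianMetric.christoffel, fderiv_leftInvariantMetric, fderiv_leftInvariantMetric,
    leftInvariantMetric_apply, hu (dMaurerCartan (γ r) a w), kForm_comm (dMaurerCartan (γ r) a w)]
  linarith

end Geodesic

/-! ### Geodesic completeness -/

namespace OscGroup

variable {n : ℕ} {lam : Fin n → ℝ}

theorem dL_eq_sub (p w : OscGroup lam) : dL p w = p * (1 + w) - p := by
  have h := mul_add_smul p 1 w 1
  rw [one_smul, one_smul, mul_one] at h
  rw [h, add_sub_cancel_left]

theorem dL_maurerCartan (p v : OscGroup lam) :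
    p.dL (mk (p.maurerCartan v).xm (p.maurerCartan v).x0 (p.maurerCartan v).zc) = v := by
  rw [maurerCartan_apply]
  exact (dL_dL p p⁻¹ v).trans (by rw [mul_inv_cancel, dL_one])

/-- A continuous curve in the Lie algebra is the body velocity of a curve in the group. The group
being solvable, the coordinates `t`, `z` and `s` are found in this order by integration. -/
theorem exists_hasDerivAt_dL {x : ℝ → OscAlgebra lam} (hx : Continuous x) (p : OscGroup lam) :
    ∃ γ : ℝ → OscGroup lam, γ 0 = p ∧
      ∀ r, HasDerivAt γ ((γ r).dL (mk (x r).xm (x r).x0 (x r).zc)) r := by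
  have hxm : Continuous fun r ↦ (x r).xm := continuous_fst.comp hx
  have hx0 : Continuous fun r ↦ (x r).x0 := (continuous_fst.comp continuous_snd).comp hx
  have hzc : ∀ j, Continuous fun r ↦ (x r).zc j := fun j ↦
    (continuous_apply j).comp ((continuous_snd.comp continuous_snd).comp hx)
  have hint : ∀ {F : Type} [NormedAddCommGroup F] [NormedSpace ℝ F] [CompleteSpace F] {f : ℝ → F},
      Continuous f → ∀ (c : F) (r : ℝ), HasDerivAt (fun r ↦ c + ∫ q in (0 : ℝ)..r, f q) (f r) r :=
    fun hf c r ↦ (hf.integral_hasStrictDerivAt 0 r).hasDerivAt.const_add c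
  have hcont : ∀ {F : Type} [NormedAddCommGroup F] [NormedSpace ℝ F] {f f' : ℝ → F},
      (∀ r, HasDerivAt f (f' r) r) → Continuous f :=
    fun hf ↦ continuous_iff_continuousAt.2 fun r ↦ (hf r).continuousAt
  set a : ℝ → ℝ := fun r ↦ t p + ∫ q in (0 : ℝ)..r, (x q).xm
  have ha : ∀ r, HasDerivAt a (x r).xm r := hint hxm (t p)
  have hrot : ∀ j, Continuous fun r ↦ rot lam (a r) j := fun j ↦
    hcont fun r ↦ hasDerivAt_rot (ha r) j
  set c : ℝ → Fin n → ℂ := fun r j ↦ z p j + ∫ q in (0 : ℝ)..r, rot lam (a q) j * (x q).zc j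
  have hc : ∀ j r, HasDerivAt (fun r ↦ c r j) (rot lam (a r) j * (x r).zc j) r := fun j ↦
    hint ((hrot j).mul (hzc j)) (z p j)
  have hs : Continuous fun r ↦ (x r).x0 +
      (1 / 2) * ∑ j, ((starRingEnd ℂ) (c r j) * rot lam (a r) j * (x r).zc j).im :=
    hx0.add (continuous_const.mul (continuous_finsetSum _ fun j _ ↦ Complex.continuous_im.comp
      (((Complex.continuous_conj.comp (hcont (hc j))).mul (hrot j)).mul (hzc j))))
  refine ⟨fun r ↦ mk (a r) (s p + ∫ q in (0 : ℝ)..r, ((x q).x0 +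
      (1 / 2) * ∑ j, ((starRingEnd ℂ) (c q j) * rot lam (a q) j * (x q).zc j).im)) (c r), ?_,
    fun r ↦ hasDerivAt_mk (ha r) (hint hs (s p) r) fun j ↦ hc j r⟩
  refine ext' ?_ ?_ fun j ↦ ?_ <;> simp [a, c]

end OscGroup

open OscAlgebra OscGroup in
/-- The geodesic is recovered from a global solution of the Euler equation by integrating its body
velocity. -/
theorem isGeodesicallyComplete_of_hasStablePlane {n : ℕ} {lam : Fin n → ℝ} (hlam : ∀ j, 0 < lam j)
    (u : OscAlgebra lam ≃ₗ[ℝ] OscAlgebra lam)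
    (hu : ∀ x y, OscAlgebra.kForm lam (u x) y = OscAlgebra.kForm lam x (u y))
    (hP : HasStablePlane u) : (leftInvariantMetric hlam u hu).IsGeodesicallyComplete := by
  intro p v
  obtain ⟨y, hy0, hy⟩ := exists_hasDerivAt_eulerField hlam hP (u (p.maurerCartan v))
  have hyc : ContDiff ℝ 1 y := by
    rw [contDiff_one_iff_deriv]
    refine ⟨fun r ↦ (hy r).differentiableAt, ?_⟩
    rw [funext fun r ↦ (hy r).deriv]
    exact (contDiff_eulerField (k := 0) u).continuous.comp
      (continuous_iff_continuousAt.2 fun r ↦ (hy r).continuousAt)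
  have hx : ContDiff ℝ 1 fun r ↦ u.symm (y r) :=
    u.symm.toLinearMap.toContinuousLinearMap.contDiff.comp hyc
  obtain ⟨γ, hγ0, hγ⟩ := exists_hasDerivAt_dL hx.continuous p
  set X : ℝ → OscGroup lam := fun r ↦
    OscGroup.mk (u.symm (y r)).xm (u.symm (y r)).x0 (u.symm (y r)).zc
  have hX : ContDiff ℝ 1 X := (ContinuousLinearMap.id ℝ (ℝ × ℝ × (Fin n → ℂ))).contDiff.comp hx
  have hγ' : deriv γ = fun r ↦ γ r * (1 + X r) - γ r :=
    funext fun r ↦ (hγ r).deriv.trans (dL_eq_sub _ _)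
  have hγd : Differentiable ℝ γ := fun r ↦ (hγ r).differentiableAt
  -- `γ'` is a smooth function of `γ` and `X`, so the differentiability of `γ` improves by one order.
  have step : ∀ k : WithTop ℕ∞, k ≤ 1 → ContDiff ℝ k γ → ContDiff ℝ k (deriv γ) := by
    intro k hk h
    rw [hγ']
    exact (contDiff_mul'.comp (h.prodMk (contDiff_const.add (hX.of_le hk)))).sub h
  have h1 : ContDiff ℝ 1 γ := contDiff_one_iff_deriv.2
    ⟨hγd, (step 0 zero_le_one (contDiff_zero.2 hγd.continuous)).continuous⟩
  have h2 : ContDiff ℝ 2 γ := by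
    rw [show (2 : WithTop ℕ∞) = 1 + 1 by norm_num, contDiff_succ_iff_deriv]
    exact ⟨hγd, by simp, step 1 le_rfl h1⟩
  refine ⟨γ, isGeodesic_of_hasDerivAt_eulerField hlam u hu h2 hy fun r ↦ ?_, hγ0, ?_⟩
  · rw [(hγ r).deriv, maurerCartan_dL]
  · rw [(hγ 0).deriv, hγ0, hy0, LinearEquiv.symm_apply_apply, dL_maurerCartan]

theorem mainTheorem2 {n : ℕ} (lam : Fin n → ℝ) (hlam : ∀ j, 0 < lam j) (hmono : Monotone lam)
    (u : OscAlgebra lam ≃ₗ[ℝ] OscAlgebra lam)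
    (hu : ∀ x y, OscAlgebra.kForm lam (u x) y = OscAlgebra.kForm lam x (u y)) :
    ((∀ x ∈ LieAlgebra.center ℝ (OscAlgebra lam), u x ∈ LieAlgebra.center ℝ (OscAlgebra lam)) →
      ∀ x ∈ LieAlgebra.derivedSeries ℝ (OscAlgebra lam) 1,
        u x ∈ LieAlgebra.derivedSeries ℝ (OscAlgebra lam) 1) ∧
    ((∀ x ∈ LieAlgebra.center ℝ (OscAlgebra lam), u x ∈ LieAlgebra.center ℝ (OscAlgebra lam)) ∨
      (∃ H : LieSubalgebra ℝ (OscAlgebra lam), H.IsCartanSubalgebra ∧ ∀ x ∈ H, u x ∈ H) →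
      (leftInvariantMetric hlam u hu).IsGeodesicallyComplete) := by
  refine ⟨fun hc x hx ↦ OscAlgebra.map_mem_derivedSeries_one hlam hu hc hx, fun h ↦
    isGeodesicallyComplete_of_hasStablePlane hlam u hu ?_⟩
  rcases h with hc | ⟨H, hH, hstable⟩
  · exact OscAlgebra.hasStablePlane_of_center_stable hlam hc
  · exact OscAlgebra.hasStablePlane_of_isCartanSubalgebra hlam H hstable
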